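/- **Theorem 3.** All functions are real-valued. For $1\le s\le\infty$ let $L_s$ be the space of $2\pi$-periodic functions with the norm $\|f\|_s=\bigl(\int_0^{2\pi}|f(t)|^s\,dt\bigr)^{1/s}$ for $s<\infty$ and $\|f\|_\infty=\operatorname{ess\,sup}_t|f(t)|$. Let $B$ be the set of positive nonincreasing functions $\psi$ on $[1,\infty)$ for which there is $K>0$ with $\psi(t)/\psi(2t)\le K$ for all $t\ge1$. For $1\le q<\infty$ let $\Theta_q$ be the set of nonincreasing functions $\psi$ on $[1,\infty)$ for which there are $\alpha>1/q$ and $K>0$ with $t_1^{\alpha}\psi(t_1)\le K\,t_2^{\alpha}\psi(t_2)$ for all $t_1>t_2\ge1$. For $\beta\in\mathbb R$ let $L^{\psi}_{\beta,1}$ be the class of $2\pi$-periodic functions $f$ that for almost all $x\in\mathbb R$ can be written as $$f(x)=\frac{a_0}{2}+\frac1\pi\int_{-\pi}^{\pi}\Psi_\beta(x-t)\varphi(t)\,dt,\qquad a_0\in\mathbb R,\quad \varphi\in L_1,\quad \|\varphi\|_1\le1,\quad \int_{-\pi}^{\pi}\varphi(t)\,dt=0,$$ where $\Psi_\beta\in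 L_1$ is the function with Fourier series $\sum_{k=1}^{\infty}\psi(k)\cos\bigl(kt-\tfrac{\beta\pi}{2}\bigr)$. For $1<p\le\infty$ and $n\in\mathbb N=\{1,2,\dots\}$ put $$\mathcal E_n(L^{\psi}_{\beta,1})_p=\sup_{f\in L^{\psi}_{\beta,1}}\|f-S_{n-1}(f)\|_p,\qquad E_n(L^{\psi}_{\beta,1})_p=\sup_{f\in L^{\psi}_{\beta,1}}\ \inf_{t_{n-1}\in\mathcal T_{2n-1}}\|f-t_{n-1}\|_p,$$ where $S_{n-1}(f)$ is the Fourier sum of $f$ of order $n-1$ and $\mathcal T_{2n-1}$ is the space of trigonometric polynomials of order at most $n-1$. Let $1<p\le\infty$, $\frac1p+\frac1{p'}=1$, let $\psi\in B\cap\Theta_{p'}$ be continuous on $[1,\infty)$, and suppose that, with $\Delta^2(1/\psi(k))=\frac1{\psi(k)}-\frac2{\psi(k+1)}+\frac1{\psi(k+2)}$, either $\Delta^2(1/\psi(k))\ge0$ for all $k\in\mathbb N$ or $\Delta^2(1/\psi(k))\le0$ for all $k\in\mathbb N$. Then there are positive numbers $K^{(3)}_{\psi,p}$ and $K^{(4)}_{\psi,p}$,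 depending only on $\psi$ and $p$, such that for all $\beta\in\mathbb R$ and all $n\in\mathbb N$ $$K^{(4)}_{\psi,p}\,\psi(n)\,n^{1/p'}\le E_n(L^{\psi}_{\beta,1})_p\le\mathcal E_n(L^{\psi}_{\beta,1})_p\le K^{(3)}_{\psi,p}\,\psi(n)\,n^{1/p'}.$$ -/

import Mathlib

open MeasureTheory Set
open scoped Real ENNReal

noncomputable section

/-- Lebesgue measure `dt` on one period `(0, 2π]` (not normalized). -/
def periodMeasure : Measure ℝ := volume.restrict (Ioc 0 (2 * π))

/-- The norm of a `2π`-periodic function in `L_p`, `1 ≤ p ≤ ∞`, with values in `[0, ∞]`: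
`(∫_0^{2π} |f|^p dt)^{1/p}` for finite `p`, the essential supremum for `p = ∞`. -/
def perNorm (p : ℝ≥0∞) (f : ℝ → ℝ) : ℝ≥0∞ := eLpNorm f p periodMeasure

/-- `f` belongs to the space `L_p` of real `2π`-periodic functions. -/
def MemPerLp (p : ℝ≥0∞) (f : ℝ → ℝ) : Prop :=
  Function.Periodic f (2 * π) ∧ MemLp f p periodMeasure

/-- The Fourier coefficient `a_k(f) = (1/π) ∫_{-π}^{π} f(t) cos(kt) dt`. -/
def cosCoeff (f : ℝ → ℝ) (k : ℕ) : ℝ := (1 / π) * ∫ t in (-π)..π, f t * Real.cos (k * t)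

/-- The Fourier coefficient `b_k(f) = (1/π) ∫_{-π}^{π} f(t) sin(kt) dt`. -/
def sinCoeff (f : ℝ → ℝ) (k : ℕ) : ℝ := (1 / π) * ∫ t in (-π)..π, f t * Real.sin (k * t)

/-- The Fourier sum of order `m`:
`S_m(f; x) = a_0/2 + ∑_{k=1}^{m} (a_k cos kx + b_k sin kx)`. -/
def fourierSum (m : ℕ) (f : ℝ → ℝ) (x : ℝ) : ℝ :=
  cosCoeff f 0 / 2 +
    ∑ k ∈ Finset.Icc 1 m, (cosCoeff f k * Real.cos (k * x) + sinCoeff f k * Real.sin (k * x))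

/-- The real trigonometric polynomials of order at most `m`. -/
def trigPolys (m : ℕ) : Set (ℝ → ℝ) :=
  {t | ∃ (c : ℝ) (a b : ℕ → ℝ), ∀ x : ℝ,
    t x = c + ∑ k ∈ Finset.Icc 1 m, (a k * Real.cos (k * x) + b k * Real.sin (k * x))}

/-- `Ψ` is a summable `2π`-periodic function whose Fourier series is
`∑_{k ≥ 1} ψ(k) cos(kt - βπ/2)
  = ∑_{k ≥ 1} (ψ(k) cos(βπ/2) cos(kt) + ψ(k) sin(βπ/2) sin(kt))`. -/
def IsKernel (ψ : ℝ → ℝ) (β : ℝ) (Ψ : ℝ → ℝ) : Prop :=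
  MemPerLp 1 Ψ ∧ cosCoeff Ψ 0 = 0 ∧
    ∀ k : ℕ, 1 ≤ k →
      cosCoeff Ψ k = ψ k * Real.cos (β * π / 2) ∧ sinCoeff Ψ k = ψ k * Real.sin (β * π / 2)

/-- The class `L^ψ_{β,s}`: the `2π`-periodic functions `f` that are, for almost all `x`, of the form
`f(x) = a_0/2 + (1/π) ∫_{-π}^{π} Ψ_β(x - t) φ(t) dt` with `a_0 ∈ ℝ`, `‖φ‖_s ≤ 1` and `φ ⊥ 1`.
The kernel `Ψ_β` is determined by `ψ` and `β` up to a null set. -/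
def psiClass (ψ : ℝ → ℝ) (β : ℝ) (s : ℝ≥0∞) : Set (ℝ → ℝ) :=
  {f | Function.Periodic f (2 * π) ∧
    ∃ (Ψ : ℝ → ℝ) (a₀ : ℝ) (φ : ℝ → ℝ), IsKernel ψ β Ψ ∧
      MemPerLp s φ ∧ perNorm s φ ≤ 1 ∧ (∫ t in (-π)..π, φ t) = 0 ∧
      ∀ᵐ x : ℝ, f x = a₀ / 2 + (1 / π) * ∫ t in (-π)..π, Ψ (x - t) * φ t}

/-- The deviation of the Fourier sums of order `n - 1` on the class `N` in the metric of `L_p`. -/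
def fourierDeviation (n : ℕ) (N : Set (ℝ → ℝ)) (p : ℝ≥0∞) : ℝ≥0∞ :=
  ⨆ f ∈ N, perNorm p (fun x => f x - fourierSum (n - 1) f x)

/-- The best approximation of the class `N` by trigonometric polynomials of order at most `n - 1`
in the metric of `L_p`. -/
def bestApprox (n : ℕ) (N : Set (ℝ → ℝ)) (p : ℝ≥0∞) : ℝ≥0∞ :=
  ⨆ f ∈ N, ⨅ t ∈ trigPolys (n - 1), perNorm p (fun x => f x - t x)

/-- The set `B`: positive nonincreasing functions on `[1, ∞)` with `ψ(t)/ψ(2t)` bounded. -/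
def classB : Set (ℝ → ℝ) :=
  {ψ | AntitoneOn ψ (Ici 1) ∧ (∀ t : ℝ, 1 ≤ t → 0 < ψ t) ∧
    ∃ K : ℝ, 0 < K ∧ ∀ t : ℝ, 1 ≤ t → ψ t / ψ (2 * t) ≤ K}

/-- The set `Θ_q`, `1 ≤ q < ∞`: nonincreasing functions on `[1, ∞)` such that `t^α ψ(t)` is almost
decreasing for some `α > 1/q`. -/
def classTheta (q : ℝ) : Set (ℝ → ℝ) :=
  {ψ | AntitoneOn ψ (Ici 1) ∧
    ∃ α : ℝ, 1 / q < α ∧ ∃ K : ℝ, 0 < K ∧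
      ∀ t₁ t₂ : ℝ, 1 ≤ t₂ → t₂ < t₁ → t₁ ^ α * ψ t₁ ≤ K * (t₂ ^ α * ψ t₂)}

/-- The second difference `Δ²(1/ψ(k)) = 1/ψ(k) - 2/ψ(k+1) + 1/ψ(k+2)`. -/
def secondDiffInv (ψ : ℝ → ℝ) (k : ℕ) : ℝ :=
  1 / ψ (k : ℝ) - 2 / ψ ((k : ℝ) + 1) + 1 / ψ ((k : ℝ) + 2)

end

open Filter Topology

/-! Upper bound. If `f = a₀/2 + (1/π) Ψ * φ`, then `f - S_{n-1} f = (1/π) R * φ` with `R = Ψ -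
S_{n-1} Ψ`, so by Young's inequality (`perNorm_perConv_le`) everything reduces to `‖R‖_p`. Let `k^α
ψ(k)` be almost decreasing with `α > 1/p'`.

For `p < ∞` one may lower `α` below 1. Abel summation bounds the blocks of the series from `n` on by
`π ψ(n)/|x|`; for `n|x| < 1`, cutting at `k ≈ 1/|x|` gives a multiple of `ψ(n) n^α |x|^{α-1}`.
Together (`AlmostDecreasing.abs_sum_le_envelope`): `|R(x)| ≤ C n ψ(n) E(n x)`, where the envelope
`E` is in `L_p(ℝ)` because `(α-1)p > -1` and `p > 1`. The dilation contributes `n^{-1/p}`, so `‖R‖_p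
≤ C ψ(n) n^{1/p'}`. For `p = ∞` one has `α > 1`, and summing absolute values gives `C n ψ(n)`.
Dominated convergence and uniqueness of Fourier coefficients identify every admissible kernel with
the pointwise sum of its series.

Lower bound, by duality. Take for `φ` a multiple of the Fejér kernel of order `6n` minus its mean:
with `γ = βπ/2`, each `cos(kx - γ)`, `n ≤ k ≤ 3n`, pairs with `f = (1/π) Ψ * φ` to at least
`ψ(k)/8`. The polynomial `g(x) = F_n(x) cos(2nx - γ)` has its spectrum in `[n, 3n]`, hence
annihilates polynomials of order `n-1`, and `‖g‖_{p'} ≤ 2π (n+1)^{1/p}`. Hölder's inequality for `∫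
g (f - t)` and `ψ(k) ≥ c ψ(n)` for `k ≤ 3n`, from the class `B`, finish (`le_bestApprox`).

The middle inequality holds because a Fourier sum is itself a competitor. -/

instance fact_two_pi_pos : Fact (0 < 2 * π) := ⟨Real.two_pi_pos⟩

/-! ### Norms and integrability over one period -/

/-- Lebesgue measure on the symmetric period `(-π, π]`. -/
noncomputable def symMeasure : Measure ℝ := volume.restrict (Ioc (-π) π)

instance : IsFiniteMeasure symMeasure := by unfold symMeasure; infer_instance

theorem intervalIntegral_eq_symMeasure (f : ℝ → ℝ) :
    ∫ t in (-π)..π, f t = ∫ t, f t ∂symMeasure := by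
  rw [intervalIntegral.integral_of_le (by linarith [Real.pi_pos]), symMeasure]

/-- `AddCircle.equivIoc` preserves measure. Since the right side does not involve `a`, all periods
give the same norm. -/
theorem Function.Periodic.eLpNorm_Ioc {f : ℝ → ℝ} {T : ℝ} [hT : Fact (0 < T)]
    (hf : Function.Periodic f T) (p : ℝ≥0∞) (a : ℝ) :
    eLpNorm f p (volume.restrict (Ioc a (a + T))) = eLpNorm hf.lift p volume := by
  have h1 : eLpNorm f p (volume.restrict (Ioc a (a + T))) =
      eLpNorm (fun x : Ioc a (a + T) => f x) p (Measure.comap Subtype.val volume) := by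
    rw [← map_comap_subtype_coe measurableSet_Ioc]
    exact (MeasurableEmbedding.subtype_coe measurableSet_Ioc).eLpNorm_map_measure
  have h2 := (AddCircle.measurePreserving_equivIoc T (a := a)).map_eq
  rw [h1, ← h2]
  have h3 : eLpNorm (fun x : Ioc a (a + T) => f x) p
      (Measure.map (AddCircle.measurableEquivIoc T a) volume) = _ :=
    (AddCircle.measurableEquivIoc T a).measurableEmbedding.eLpNorm_map_measure
  refine h3.trans ?_
  congr 1
  ext y
  have : ((AddCircle.measurableEquivIoc T a y : ℝ) : AddCircle T) = y :=
    (AddCircle.equivIoc T a).symm_apply_apply y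
  simp only [Function.comp_apply]
  conv_rhs => rw [← this]
  rfl

theorem perNorm_eq_of_periodic {f : ℝ → ℝ} (hf : Function.Periodic f (2 * π)) (p : ℝ≥0∞) (a : ℝ) :
    perNorm p f = eLpNorm f p (volume.restrict (Ioc a (a + 2 * π))) := by
  have h := hf.eLpNorm_Ioc p 0
  rw [zero_add] at h
  rw [perNorm, periodMeasure, h, hf.eLpNorm_Ioc]

theorem perNorm_eq_symMeasure {f : ℝ → ℝ} (hf : Function.Periodic f (2 * π)) (p : ℝ≥0∞) :
    perNorm p f = eLpNorm f p symMeasure := by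
  rw [perNorm_eq_of_periodic hf p (-π), symMeasure]
  congr 4; ring

theorem perNorm_comp_sub {f : ℝ → ℝ} (hf : Function.Periodic f (2 * π)) (p : ℝ≥0∞) (t : ℝ) :
    eLpNorm (fun x => f (x - t)) p symMeasure = perNorm p f := by
  rw [perNorm_eq_of_periodic hf p (-π - t), symMeasure]
  have h := (measurePreserving_sub_right volume t).restrict_preimage
    (s := Ioc (-π - t) (-π - t + 2 * π)) measurableSet_Ioc
  have e : (fun x => x - t) ⁻¹' Ioc (-π - t) (-π - t + 2 * π) = Ioc (-π) π := by
    ext x; simp only [mem_preimage, mem_Ioc]; constructor <;> rintro ⟨h1, h2⟩ <;>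
      constructor <;> linarith
  rw [e] at h
  have := (MeasurableEquiv.subRight t).measurableEmbedding.eLpNorm_map_measure (g := f) (p := p)
    (μ := volume.restrict (Ioc (-π) π))
  have h2 : Measure.map (MeasurableEquiv.subRight t) (volume.restrict (Ioc (-π) π)) =
      volume.restrict (Ioc (-π - t) (-π - t + 2 * π)) := h.map_eq
  rw [h2] at this
  exact this.symm

theorem MemPerLp.intervalIntegrable {f : ℝ → ℝ} (hf : MemPerLp 1 f) (a b : ℝ) :
    IntervalIntegrable f volume a b := by
  refine hf.1.intervalIntegrable₀ Real.two_pi_pos.ne' ?_ a b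
  rw [intervalIntegrable_iff_integrableOn_Ioc_of_le Real.two_pi_pos.le]
  exact memLp_one_iff_integrable.1 hf.2

theorem memPerLp_one_iff {f : ℝ → ℝ} (hf : Function.Periodic f (2 * π)) :
    MemPerLp 1 f ↔ Integrable f symMeasure := by
  constructor
  · intro h
    exact (intervalIntegrable_iff_integrableOn_Ioc_of_le (by linarith [Real.pi_pos])).1
      (h.intervalIntegrable (-π) π)
  · intro h
    refine ⟨hf, memLp_one_iff_integrable.2 ?_⟩
    have h1 : IntervalIntegrable f volume (-π) (-π + 2 * π) := by
      rw [show -π + 2 * π = π by ring]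
      exact (intervalIntegrable_iff_integrableOn_Ioc_of_le (by linarith [Real.pi_pos])).2 h
    exact (intervalIntegrable_iff_integrableOn_Ioc_of_le Real.two_pi_pos.le).1
      (hf.intervalIntegrable Real.two_pi_pos.ne' h1 0 (2 * π))

theorem MemPerLp.integrable {f : ℝ → ℝ} (hf : MemPerLp 1 f) : Integrable f symMeasure :=
  (memPerLp_one_iff hf.1).1 hf

/-- `MemPerLp` speaks of one period only, but `Ψ (x - t)` with both variables free leaves it; local
integrability gives measurability on the line. -/
theorem MemPerLp.aestronglyMeasurable {f : ℝ → ℝ} (hf : MemPerLp 1 f) :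
    AEStronglyMeasurable f volume := by
  refine LocallyIntegrable.aestronglyMeasurable ?_
  rw [locallyIntegrable_iff]
  intro k hk
  obtain ⟨a, b, hab⟩ : ∃ a b : ℝ, k ⊆ Ioc a b := by
    obtain ⟨r, hr⟩ := hk.isBounded.subset_closedBall 0
    refine ⟨-r - 1, r, hr.trans ?_⟩
    rw [Real.closedBall_eq_Icc]
    intro x hx
    exact ⟨by linarith [hx.1], by linarith [hx.2]⟩
  rcases le_total a b with h | h
  · exact ((intervalIntegrable_iff_integrableOn_Ioc_of_le h).1
      (hf.intervalIntegrable a b)).mono_set hab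
  · rw [Ioc_eq_empty (by linarith)] at hab
    rw [subset_empty_iff.1 hab]; exact integrableOn_empty

/-! ### Periodic convolution and Young's inequality -/

/-- On the square `x - t` stays in `(-2π, 2π]`, so `Ψ` may be truncated to an integrable function on
the line, where the usual convolution integrand is integrable. -/
theorem integrable_prod_conv {Ψ φ : ℝ → ℝ} (hΨ : MemPerLp 1 Ψ) (hφ : MemPerLp 1 φ) :
    Integrable (fun z : ℝ × ℝ => Ψ (z.1 - z.2) * φ z.2) (symMeasure.prod symMeasure) := by
  have h1 : Integrable ((Ioc (-(2 * π)) (2 * π)).indicator Ψ) volume := by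
    rw [integrable_indicator_iff measurableSet_Ioc]
    exact (intervalIntegrable_iff_integrableOn_Ioc_of_le (by linarith [Real.pi_pos])).1
      (hΨ.intervalIntegrable _ _)
  have h2 := hφ.integrable.convolution_integrand (ContinuousLinearMap.mul ℝ ℝ) h1
  have h3 : symMeasure.prod symMeasure ≤ volume.prod symMeasure :=
    Measure.prod_mono Measure.restrict_le_self le_rfl
  refine (h2.mono_measure h3).congr ?_
  have : symMeasure.prod symMeasure =
      (volume.prod volume).restrict (Ioc (-π) π ×ˢ Ioc (-π) π) := by
    simp [symMeasure, Measure.prod_restrict]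
  rw [this]
  refine (ae_restrict_iff' (measurableSet_Ioc.prod measurableSet_Ioc)).2 (Eventually.of_forall ?_)
  rintro ⟨x, t⟩ ⟨⟨hx1, hx2⟩, ⟨ht1, ht2⟩⟩
  simp only at hx1 hx2 ht1 ht2 ⊢
  rw [indicator_of_mem (show x - t ∈ Ioc (-(2 * π)) (2 * π) from ⟨by linarith, by linarith⟩)]
  simp [mul_comm]

/-- The periodic convolution `∫_{-π}^{π} Ψ(x - t) φ(t) dt`. -/
noncomputable def perConv (Ψ φ : ℝ → ℝ) (x : ℝ) : ℝ := ∫ t in (-π)..π, Ψ (x - t) * φ t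

theorem perConv_periodic {Ψ : ℝ → ℝ} (φ : ℝ → ℝ) (hΨ : Function.Periodic Ψ (2 * π)) :
    Function.Periodic (perConv Ψ φ) (2 * π) := by
  intro x
  simp only [perConv]
  congr 1; ext t
  rw [show x + 2 * π - t = x - t + 2 * π by ring, hΨ]

theorem integrable_perConv {Ψ φ : ℝ → ℝ} (hΨ : MemPerLp 1 Ψ) (hφ : MemPerLp 1 φ) :
    Integrable (perConv Ψ φ) symMeasure := by
  have := (integrable_prod_conv hΨ hφ).integral_prod_left
  refine this.congr (Eventually.of_forall fun x => ?_)
  simp [perConv, intervalIntegral_eq_symMeasure]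

theorem memPerLp_perConv {Ψ φ : ℝ → ℝ} (hΨ : MemPerLp 1 Ψ) (hφ : MemPerLp 1 φ) :
    MemPerLp 1 (perConv Ψ φ) :=
  (memPerLp_one_iff (perConv_periodic φ hΨ.1)).2 (integrable_perConv hΨ hφ)

theorem enorm_perConv_le (Ψ φ : ℝ → ℝ) (x : ℝ) :
    ‖perConv Ψ φ x‖ₑ ≤ ∫⁻ t, ‖Ψ (x - t)‖ₑ * ‖φ t‖ₑ ∂symMeasure := by
  rw [perConv, intervalIntegral_eq_symMeasure]
  refine (enorm_integral_le_lintegral_enorm _).trans (le_of_eq ?_)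
  simp [enorm_mul]

/-- Hölder's inequality after splitting `w = w^{1/q} w^{1/r}`; in Young's inequality the weight is
`|φ|`. -/
theorem lintegral_mul_rpow_le {α : Type*} [MeasurableSpace α] (μ : Measure α) {q : ℝ} (hq : 1 ≤ q)
    {u w : α → ℝ≥0∞} (hu : AEMeasurable u μ) (hw : AEMeasurable w μ) :
    (∫⁻ t, u t * w t ∂μ) ^ q ≤ (∫⁻ t, u t ^ q * w t ∂μ) * (∫⁻ t, w t ∂μ) ^ (q - 1) := by
  rcases hq.eq_or_lt with rfl | hq1
  · simp
  have hpq := Real.HolderConjugate.conjExponent hq1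
  set r := Real.conjExponent q
  have hq0 : 0 < q := by linarith
  have hr0 : 0 < r := hpq.symm.pos
  have key := ENNReal.lintegral_mul_le_Lp_mul_Lq μ hpq (f := fun t => u t * w t ^ (1 / q))
    (g := fun t => w t ^ (1 / r)) (hu.mul (hw.pow_const _)) (hw.pow_const _)
  have e1 : ∀ t, u t * w t ^ (1 / q) * w t ^ (1 / r) = u t * w t := by
    intro t
    rw [mul_assoc, ← ENNReal.rpow_add_of_nonneg _ _ (by positivity) (by positivity)]
    have := hpq.inv_add_inv_eq_one
    rw [one_div, one_div, this, ENNReal.rpow_one]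
  have e2 : ∀ t, (u t * w t ^ (1 / q)) ^ q = u t ^ q * w t := by
    intro t
    rw [ENNReal.mul_rpow_of_nonneg _ _ hq0.le, ← ENNReal.rpow_mul, one_div,
      inv_mul_cancel₀ hq0.ne', ENNReal.rpow_one]
  have e3 : ∀ t, (w t ^ (1 / r)) ^ r = w t := by
    intro t
    rw [← ENNReal.rpow_mul, one_div, inv_mul_cancel₀ hr0.ne', ENNReal.rpow_one]
  simp only [Pi.mul_apply, e1, e2, e3] at key
  calc (∫⁻ t, u t * w t ∂μ) ^ q
      ≤ ((∫⁻ t, u t ^ q * w t ∂μ) ^ (1 / q) * (∫⁻ t, w t ∂μ) ^ (1 / r)) ^ q := by gcongr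
    _ = _ := by
      rw [ENNReal.mul_rpow_of_nonneg _ _ hq0.le, ← ENNReal.rpow_mul, ← ENNReal.rpow_mul, one_div,
        inv_mul_cancel₀ hq0.ne', ENNReal.rpow_one]
      congr 2
      have := hpq.inv_add_inv_eq_one
      have h : r⁻¹ = 1 - q⁻¹ := by linarith
      rw [one_div, h]; field_simp

theorem aemeasurable_prod_conv {Ψ φ : ℝ → ℝ} (hΨ : MemPerLp 1 Ψ) (hφ : MemPerLp 1 φ) (q : ℝ) :
    AEMeasurable (fun z : ℝ × ℝ => ‖Ψ (z.1 - z.2)‖ₑ ^ q * ‖φ z.2‖ₑ)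
      (symMeasure.prod symMeasure) := by
  have h1 : AEStronglyMeasurable (fun z : ℝ × ℝ => Ψ (z.1 - z.2)) (symMeasure.prod symMeasure) := by
    refine hΨ.aestronglyMeasurable.comp_quasiMeasurePreserving ?_
    have := quasiMeasurePreserving_sub_of_right_invariant (volume : Measure ℝ) symMeasure
    refine this.mono_left ?_
    exact (Measure.absolutelyContinuous_of_le Measure.restrict_le_self).prod
      Measure.AbsolutelyContinuous.rfl
  have h2 : AEStronglyMeasurable (fun z : ℝ × ℝ => φ z.2) (symMeasure.prod symMeasure) :=
    hφ.integrable.aestronglyMeasurable.comp_snd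
  exact (h1.enorm.pow_const _).mul h2.enorm

theorem aestronglyMeasurable_comp_const_sub {Ψ : ℝ → ℝ} (hΨ : MemPerLp 1 Ψ) (x : ℝ) :
    AEStronglyMeasurable (fun t => Ψ (x - t)) symMeasure :=
  (hΨ.aestronglyMeasurable.comp_quasiMeasurePreserving
    (quasiMeasurePreserving_sub_left volume x)).mono_measure Measure.restrict_le_self

/-- Young's inequality `‖Ψ * φ‖_p ≤ ‖Ψ‖_p ‖φ‖_1` for periodic functions. -/
theorem perNorm_perConv_le {Ψ φ : ℝ → ℝ} (hΨ : MemPerLp 1 Ψ) (hφ : MemPerLp 1 φ) {p : ℝ≥0∞}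
    (hp : 1 ≤ p) : perNorm p (perConv Ψ φ) ≤ perNorm p Ψ * perNorm 1 φ := by
  have hφ1 : perNorm 1 φ = ∫⁻ t, ‖φ t‖ₑ ∂symMeasure := by
    rw [perNorm_eq_symMeasure hφ.1, eLpNorm_one_eq_lintegral_enorm]
  rw [perNorm_eq_symMeasure (perConv_periodic φ hΨ.1)]
  rcases eq_or_ne p ∞ with rfl | hpt
  · rw [eLpNorm_exponent_top]
    refine essSup_le_of_ae_le _ (Eventually.of_forall fun x => ?_)
    refine (enorm_perConv_le Ψ φ x).trans ?_
    rw [hφ1, ← lintegral_const_mul'' _ hφ.integrable.aestronglyMeasurable.enorm]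
    refine lintegral_mono_ae ?_
    -- Reflection maps `(-π, π]` to `[x - π, x + π)`, a full period up to a null set, so this holds
    -- for every `x`.
    have e : eLpNorm (fun t => Ψ (x - t)) ∞ symMeasure = perNorm ∞ Ψ := by
      have h1 : eLpNorm (fun t => Ψ (x - t)) ∞ symMeasure =
          eLpNorm Ψ ∞ (volume.restrict (Ico (x - π) (x + π))) := by
        have := (Homeomorph.subLeft x).toMeasurableEquiv.measurableEmbedding.eLpNorm_map_measure
          (g := Ψ) (p := ∞) (μ := symMeasure)
        have h := (Measure.measurePreserving_sub_left volume x).restrict_preimage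
          (s := Ico (x - π) (x + π)) measurableSet_Ico
        have e : (fun t => x - t) ⁻¹' Ico (x - π) (x + π) = Ioc (-π) π := by
          ext t; simp only [mem_preimage, mem_Ioc, mem_Ico]; constructor <;> rintro ⟨h1, h2⟩ <;>
            constructor <;> linarith
        rw [e] at h
        have h2 : Measure.map (Homeomorph.subLeft x).toMeasurableEquiv symMeasure =
          volume.restrict (Ico (x - π) (x + π)) := h.map_eq
        rw [h2] at this
        exact this.symm
      rw [h1, restrict_Ico_eq_restrict_Ioc, perNorm_eq_of_periodic hΨ.1 ∞ (x - π),
        show x - π + 2 * π = x + π by ring]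
    have := ae_le_eLpNormEssSup (f := fun t => Ψ (x - t)) (μ := symMeasure)
    rw [← eLpNorm_exponent_top, e] at this
    filter_upwards [this] with t ht
    gcongr
  · have hp0 : p ≠ 0 := by rintro rfl; simp at hp
    set q := p.toReal with hqdef
    have hq : 1 ≤ q := by
      have := ENNReal.toReal_mono hpt hp
      simpa using this
    have hq0 : 0 < q := by linarith
    rw [eLpNorm_eq_lintegral_rpow_enorm_toReal hp0 hpt, ← hqdef]
    have hφm : AEMeasurable (fun t => ‖φ t‖ₑ) symMeasure :=
      hφ.integrable.aestronglyMeasurable.enorm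
    have hshift : ∀ t, ∫⁻ x, ‖Ψ (x - t)‖ₑ ^ q ∂symMeasure = perNorm p Ψ ^ q := by
      intro t
      rw [← perNorm_comp_sub hΨ.1 p t, eLpNorm_eq_lintegral_rpow_enorm_toReal hp0 hpt, ← hqdef,
        ← ENNReal.rpow_mul, one_div, inv_mul_cancel₀ hq0.ne', ENNReal.rpow_one]
    -- Weighted Hölder, then Tonelli; each inner `x`-integral is a translate and equals `‖Ψ‖_p^q`.
    have main : ∫⁻ x, ‖perConv Ψ φ x‖ₑ ^ q ∂symMeasure ≤ (perNorm p Ψ * perNorm 1 φ) ^ q := by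
      calc ∫⁻ x, ‖perConv Ψ φ x‖ₑ ^ q ∂symMeasure
          ≤ ∫⁻ x, (∫⁻ t, ‖Ψ (x - t)‖ₑ ^ q * ‖φ t‖ₑ ∂symMeasure) * perNorm 1 φ ^ (q - 1)
              ∂symMeasure := by
            refine lintegral_mono fun x => ?_
            refine (ENNReal.rpow_le_rpow (enorm_perConv_le Ψ φ x) hq0.le).trans ?_
            rw [hφ1]
            exact lintegral_mul_rpow_le _ hq (aestronglyMeasurable_comp_const_sub hΨ x).enorm hφm
        _ = (∫⁻ x, ∫⁻ t, ‖Ψ (x - t)‖ₑ ^ q * ‖φ t‖ₑ ∂symMeasure ∂symMeasure) *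
              perNorm 1 φ ^ (q - 1) := by
            rw [lintegral_mul_const'' _ (aemeasurable_prod_conv hΨ hφ q).lintegral_prod_right']
        _ = (∫⁻ t, ∫⁻ x, ‖Ψ (x - t)‖ₑ ^ q * ‖φ t‖ₑ ∂symMeasure ∂symMeasure) *
              perNorm 1 φ ^ (q - 1) := by
            rw [lintegral_lintegral_swap (aemeasurable_prod_conv hΨ hφ q)]
        _ = (∫⁻ t, perNorm p Ψ ^ q * ‖φ t‖ₑ ∂symMeasure) * perNorm 1 φ ^ (q - 1) := by
            congr 2; ext t
            rw [lintegral_mul_const' _ _ enorm_ne_top, hshift]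
        _ = perNorm p Ψ ^ q * (perNorm 1 φ * perNorm 1 φ ^ (q - 1)) := by
            rw [lintegral_const_mul'' _ hφm, hφ1, mul_assoc]
        _ = (perNorm p Ψ * perNorm 1 φ) ^ q := by
            rw [ENNReal.mul_rpow_of_nonneg _ _ hq0.le]
            congr 1
            conv_lhs => rw [← ENNReal.rpow_one (perNorm 1 φ)]
            rw [← ENNReal.rpow_mul, ← ENNReal.rpow_add_of_nonneg _ _ zero_le_one (by linarith)]
            congr 1; ring
    calc _ ≤ ((perNorm p Ψ * perNorm 1 φ) ^ q) ^ (1 / q) := by gcongr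
      _ = _ := by rw [← ENNReal.rpow_mul, mul_one_div_cancel hq0.ne', ENNReal.rpow_one]

/-! ### Fourier coefficients of convolutions and the deviation of Fourier sums -/

theorem Integrable.mul_cos_affine {f : ℝ → ℝ} {μ : Measure ℝ} (hf : Integrable f μ) (k c : ℝ) :
    Integrable (fun t => f t * Real.cos (k * t + c)) μ := by
  refine hf.mul_bdd (c := 1) (by fun_prop) (Eventually.of_forall fun t => ?_)
  exact Real.abs_cos_le_one _

theorem Integrable.mul_cos_mul {f : ℝ → ℝ} {μ : Measure ℝ} (hf : Integrable f μ) (k : ℝ) :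
    Integrable (fun t => f t * Real.cos (k * t)) μ := by
  simpa using Integrable.mul_cos_affine hf k 0

theorem Integrable.mul_sin_mul {f : ℝ → ℝ} {μ : Measure ℝ} (hf : Integrable f μ) (k : ℝ) :
    Integrable (fun t => f t * Real.sin (k * t)) μ := by
  have := Integrable.mul_cos_affine hf k (-(π / 2))
  refine this.congr (Eventually.of_forall fun t => ?_)
  simp only [← sub_eq_add_neg, Real.cos_sub_pi_div_two]

theorem integral_mul_cos_mul (f : ℝ → ℝ) (k : ℕ) :
    ∫ t, f t * Real.cos (k * t) ∂symMeasure = π * cosCoeff f k := by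
  rw [cosCoeff, intervalIntegral_eq_symMeasure, ← mul_assoc, mul_one_div_cancel Real.pi_ne_zero,
    one_mul]

theorem integral_mul_sin_mul (f : ℝ → ℝ) (k : ℕ) :
    ∫ t, f t * Real.sin (k * t) ∂symMeasure = π * sinCoeff f k := by
  rw [sinCoeff, intervalIntegral_eq_symMeasure, ← mul_assoc, mul_one_div_cancel Real.pi_ne_zero,
    one_mul]

theorem integral_mul_cos_affine {f : ℝ → ℝ} (hf : Integrable f symMeasure) (k : ℕ) (c : ℝ) :
    ∫ t, f t * Real.cos (k * t + c) ∂symMeasure =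
      π * (cosCoeff f k * Real.cos c - sinCoeff f k * Real.sin c) := by
  have : ∀ t, f t * Real.cos (k * t + c) =
      f t * Real.cos (k * t) * Real.cos c - f t * Real.sin (k * t) * Real.sin c := by
    intro t; rw [Real.cos_add]; ring
  simp only [this]
  rw [integral_sub ((Integrable.mul_cos_mul hf k).mul_const _)
    ((Integrable.mul_sin_mul hf k).mul_const _), integral_mul_const, integral_mul_const,
    integral_mul_cos_mul, integral_mul_sin_mul]
  ring

theorem integral_mul_sin_affine {f : ℝ → ℝ} (hf : Integrable f symMeasure) (k : ℕ) (c : ℝ) :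
    ∫ t, f t * Real.sin (k * t + c) ∂symMeasure =
      π * (cosCoeff f k * Real.sin c + sinCoeff f k * Real.cos c) := by
  have := integral_mul_cos_affine hf k (c - π / 2)
  rw [Real.cos_sub_pi_div_two, Real.sin_sub_pi_div_two] at this
  simp only [← add_sub_assoc, Real.cos_sub_pi_div_two] at this
  rw [this]; ring

theorem cos_affine_periodic (k : ℕ) (c : ℝ) :
    Function.Periodic (fun x : ℝ => Real.cos (k * x + c)) (2 * π) := by
  intro x
  simp only
  rw [show (k : ℝ) * (x + 2 * π) + c = k * x + c + k * (2 * π) by ring, Real.cos_add_nat_mul_two_pi]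

theorem integral_comp_sub_mul_cos {Ψ : ℝ → ℝ} (hΨ : MemPerLp 1 Ψ) (k : ℕ) (c t : ℝ) :
    ∫ x, Ψ (x - t) * Real.cos (k * x + c) ∂symMeasure =
      π * (cosCoeff Ψ k * Real.cos (k * t + c) - sinCoeff Ψ k * Real.sin (k * t + c)) := by
  rw [← integral_mul_cos_affine hΨ.integrable, ← intervalIntegral_eq_symMeasure,
    ← intervalIntegral_eq_symMeasure]
  set h : ℝ → ℝ := fun u => Ψ u * Real.cos (k * u + (k * t + c)) with hh
  have hper : Function.Periodic h (2 * π) := hΨ.1.mul (cos_affine_periodic k _)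
  have e : ∀ x, Ψ (x - t) * Real.cos (k * x + c) = h (x - t) := by
    intro x; simp only [hh]; congr 2; ring
  simp only [e]
  rw [intervalIntegral.integral_comp_sub_right]
  have := hper.intervalIntegral_add_eq (-π - t) (-π)
  rw [show -π - t + 2 * π = π - t by ring, show -π + 2 * π = π by ring] at this
  exact this

/-- Fubini, then a shift in the inner integral. The free phase serves both kinds of coefficients: `c
= 0` for cosine, `c = -π/2` for sine. -/
theorem integral_perConv_mul_cos {Ψ φ : ℝ → ℝ} (hΨ : MemPerLp 1 Ψ) (hφ : MemPerLp 1 φ)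
    (k : ℕ) (c : ℝ) :
    ∫ x, perConv Ψ φ x * Real.cos (k * x + c) ∂symMeasure =
      π * (π * (cosCoeff Ψ k * (cosCoeff φ k * Real.cos c - sinCoeff φ k * Real.sin c) -
        sinCoeff Ψ k * (cosCoeff φ k * Real.sin c + sinCoeff φ k * Real.cos c))) := by
  have hint : Integrable (fun z : ℝ × ℝ => Ψ (z.1 - z.2) * φ z.2 * Real.cos (k * z.1 + c))
      (symMeasure.prod symMeasure) := by
    refine (integrable_prod_conv hΨ hφ).mul_bdd (c := 1) (by fun_prop)
      (Eventually.of_forall fun t => ?_)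
    exact Real.abs_cos_le_one _
  calc ∫ x, perConv Ψ φ x * Real.cos (k * x + c) ∂symMeasure
      = ∫ x, ∫ t, Ψ (x - t) * φ t * Real.cos (k * x + c) ∂symMeasure ∂symMeasure := by
        simp only [perConv, intervalIntegral_eq_symMeasure, integral_mul_const]
    _ = ∫ t, ∫ x, Ψ (x - t) * φ t * Real.cos (k * x + c) ∂symMeasure ∂symMeasure :=
        integral_integral_swap hint
    _ = ∫ t, π * (cosCoeff Ψ k * (φ t * Real.cos (k * t + c)) -
          sinCoeff Ψ k * (φ t * Real.sin (k * t + c))) ∂symMeasure := by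
        congr 1; ext t
        have : ∀ x, Ψ (x - t) * φ t * Real.cos (k * x + c) =
            φ t * (Ψ (x - t) * Real.cos (k * x + c)) := fun x => by ring
        simp only [this]
        rw [integral_const_mul, integral_comp_sub_mul_cos hΨ]; ring
    _ = _ := by
        have h1 := Integrable.mul_cos_affine hφ.integrable k c
        have h2 : Integrable (fun t => φ t * Real.sin (k * t + c)) symMeasure := by
          have := Integrable.mul_cos_affine hφ.integrable k (c - π / 2)
          simpa only [← add_sub_assoc, Real.cos_sub_pi_div_two] using this
        rw [integral_const_mul, integral_sub (h1.const_mul _) (h2.const_mul _),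
          integral_const_mul, integral_const_mul, integral_mul_cos_affine hφ.integrable,
          integral_mul_sin_affine hφ.integrable]
        ring

theorem cosCoeff_perConv {Ψ φ : ℝ → ℝ} (hΨ : MemPerLp 1 Ψ) (hφ : MemPerLp 1 φ) (k : ℕ) :
    cosCoeff (perConv Ψ φ) k =
      π * (cosCoeff Ψ k * cosCoeff φ k - sinCoeff Ψ k * sinCoeff φ k) := by
  have := integral_perConv_mul_cos hΨ hφ k 0
  simp only [add_zero, integral_mul_cos_mul] at this
  have h2 := mul_left_cancel₀ Real.pi_ne_zero this
  rw [h2, Real.cos_zero, Real.sin_zero]; ring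

theorem sinCoeff_perConv {Ψ φ : ℝ → ℝ} (hΨ : MemPerLp 1 Ψ) (hφ : MemPerLp 1 φ) (k : ℕ) :
    sinCoeff (perConv Ψ φ) k =
      π * (cosCoeff Ψ k * sinCoeff φ k + sinCoeff Ψ k * cosCoeff φ k) := by
  have := integral_perConv_mul_cos hΨ hφ k (-(π / 2))
  simp only [← sub_eq_add_neg, Real.cos_sub_pi_div_two, integral_mul_sin_mul] at this
  have h2 := mul_left_cancel₀ Real.pi_ne_zero this
  rw [h2, Real.cos_neg, Real.sin_neg, Real.cos_pi_div_two, Real.sin_pi_div_two]; ring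

theorem fourierSum_periodic (m : ℕ) (f : ℝ → ℝ) : Function.Periodic (fourierSum m f) (2 * π) := by
  intro x
  simp only [fourierSum]
  congr 1
  refine Finset.sum_congr rfl fun k _ => ?_
  have h1 : (k : ℝ) * (x + 2 * π) = k * x + k * (2 * π) := by ring
  rw [h1, Real.cos_add_nat_mul_two_pi, Real.sin_add_nat_mul_two_pi]

theorem continuous_fourierSum (m : ℕ) (f : ℝ → ℝ) : Continuous (fourierSum m f) := by
  unfold fourierSum; fun_prop

theorem Continuous.memPerLp_one {f : ℝ → ℝ} (hc : Continuous f)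
    (hf : Function.Periodic f (2 * π)) : MemPerLp 1 f := by
  rw [memPerLp_one_iff hf, symMeasure]
  exact (hc.integrableOn_Icc (μ := volume) (a := -π) (b := π)).mono_set Ioc_subset_Icc_self

theorem fourierSum_mem_trigPolys (m : ℕ) (f : ℝ → ℝ) : fourierSum m f ∈ trigPolys m :=
  ⟨cosCoeff f 0 / 2, cosCoeff f, sinCoeff f, fun _ => rfl⟩

/-- Convolution acts on each frequency separately, hence commutes with truncation. Both sides are
trigonometric polynomials, so equality holds at every `x`. -/
theorem perConv_fourierSum (m : ℕ) {Ψ φ : ℝ → ℝ} (hΨ : MemPerLp 1 Ψ) (hφ : MemPerLp 1 φ) (x : ℝ) :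
    perConv (fourierSum m Ψ) φ x = fourierSum m (perConv Ψ φ) x := by
  have hs0 : ∀ f : ℝ → ℝ, sinCoeff f 0 = 0 := fun f => by simp [sinCoeff]
  have hφ0 : ∫ t, φ t ∂symMeasure = π * cosCoeff φ 0 := by
    simpa using integral_mul_cos_mul φ 0
  have e : ∀ t, fourierSum m Ψ (x - t) * φ t = cosCoeff Ψ 0 / 2 * φ t +
      ∑ k ∈ Finset.Icc 1 m,
        (cosCoeff Ψ k * (φ t * Real.cos (k * t + -(k * x))) -
          sinCoeff Ψ k * (φ t * Real.sin (k * t + -(k * x)))) := by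
    intro t
    rw [fourierSum, add_mul, Finset.sum_mul]
    congr 1
    refine Finset.sum_congr rfl fun k _ => ?_
    rw [show (k : ℝ) * (x - t) = -(k * t + -(k * x)) by ring, Real.cos_neg, Real.sin_neg]
    ring
  have hsin : ∀ k c : ℝ, Integrable (fun t => φ t * Real.sin (k * t + c)) symMeasure := by
    intro k c
    have := Integrable.mul_cos_affine hφ.integrable k (c - π / 2)
    simpa only [← add_sub_assoc, Real.cos_sub_pi_div_two] using this
  have hcos := Integrable.mul_cos_affine hφ.integrable
  rw [perConv, intervalIntegral_eq_symMeasure]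
  simp only [e]
  have hT : ∀ k ∈ Finset.Icc 1 m, Integrable (fun t =>
      cosCoeff Ψ k * (φ t * Real.cos (k * t + -(k * x))) -
        sinCoeff Ψ k * (φ t * Real.sin (k * t + -(k * x)))) symMeasure :=
    fun k _ => ((hcos _ _).const_mul _).sub ((hsin _ _).const_mul _)
  rw [integral_add (hφ.integrable.const_mul _) (integrable_finsetSum _ hT),
    integral_finsetSum _ hT,
    integral_const_mul, hφ0, fourierSum, cosCoeff_perConv hΨ hφ, hs0]
  congr 1
  · ring
  · refine Finset.sum_congr rfl fun k _ => ?_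
    rw [integral_sub ((hcos _ _).const_mul _) ((hsin _ _).const_mul _), integral_const_mul,
      integral_const_mul, integral_mul_cos_affine hφ.integrable,
      integral_mul_sin_affine hφ.integrable, cosCoeff_perConv hΨ hφ, sinCoeff_perConv hΨ hφ,
      Real.cos_neg, Real.sin_neg]
    ring

/-- Linearity of the integral needs `t ↦ Ψ (x - t) φ t` to be integrable, which Fubini provides only
for almost every `x`. -/
theorem perConv_sub_ae {Ψ Λ φ : ℝ → ℝ} (hΨ : MemPerLp 1 Ψ) (hΛ : MemPerLp 1 Λ)
    (hφ : MemPerLp 1 φ) :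
    perConv (fun u => Ψ u - Λ u) φ =ᵐ[symMeasure] fun x => perConv Ψ φ x - perConv Λ φ x := by
  filter_upwards [(integrable_prod_conv hΨ hφ).prod_right_ae,
    (integrable_prod_conv hΛ hφ).prod_right_ae] with x h1 h2
  simp only [perConv, intervalIntegral_eq_symMeasure, sub_mul]
  exact integral_sub h1 h2

theorem cosCoeff_congr {f g : ℝ → ℝ} (h : f =ᵐ[symMeasure] g) (k : ℕ) :
    cosCoeff f k = cosCoeff g k := by
  simp only [cosCoeff, intervalIntegral_eq_symMeasure]
  congr 1
  exact integral_congr_ae (h.mono fun x hx => by simp only [hx])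

theorem sinCoeff_congr {f g : ℝ → ℝ} (h : f =ᵐ[symMeasure] g) (k : ℕ) :
    sinCoeff f k = sinCoeff g k := by
  simp only [sinCoeff, intervalIntegral_eq_symMeasure]
  congr 1
  exact integral_congr_ae (h.mono fun x hx => by simp only [hx])

theorem fourierSum_congr {f g : ℝ → ℝ} (h : f =ᵐ[symMeasure] g) (m : ℕ) :
    fourierSum m f = fourierSum m g := by
  ext x
  simp only [fourierSum, cosCoeff_congr h, sinCoeff_congr h]

theorem integral_cos_int_mul_add {l : ℤ} (hl : l ≠ 0) (c : ℝ) :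
    ∫ x, Real.cos (l * x + c) ∂symMeasure = 0 := by
  have hl' : (l : ℝ) ≠ 0 := by exact_mod_cast hl
  rw [← intervalIntegral_eq_symMeasure,
    intervalIntegral.integral_comp_mul_add (fun x => Real.cos x) hl', integral_cos,
    show (l : ℝ) * π + c = l * -π + c + l * (2 * π) by ring, Real.sin_add_int_mul_two_pi]
  simp

theorem integral_cos_nat_mul_add {k : ℕ} (hk : 1 ≤ k) (c : ℝ) :
    ∫ x, Real.cos (k * x + c) ∂symMeasure = 0 := by
  have := integral_cos_int_mul_add (l := k) (by exact_mod_cast (by omega : k ≠ 0)) c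
  simpa using this

theorem integral_const_symMeasure (c : ℝ) : ∫ _, c ∂symMeasure = 2 * π * c := by
  rw [← intervalIntegral_eq_symMeasure, intervalIntegral.integral_const, smul_eq_mul]; ring

theorem cosCoeff_affine_perConv (a₀ : ℝ) {F : ℝ → ℝ} (hF : MemPerLp 1 F) (k : ℕ) :
    cosCoeff (fun x => a₀ / 2 + 1 / π * F x) k =
      (if k = 0 then a₀ else 0) + 1 / π * cosCoeff F k := by
  have h1 : Integrable (fun x : ℝ => a₀ / 2 * Real.cos (k * x)) symMeasure :=
    Integrable.mul_cos_mul (f := fun _ => a₀ / 2) (integrable_const _) k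
  have h2 : Integrable (fun x : ℝ => 1 / π * (F x * Real.cos (k * x))) symMeasure :=
    (Integrable.mul_cos_mul hF.integrable k).const_mul _
  have h3 : ∫ x, (a₀ / 2 + 1 / π * F x) * Real.cos (k * x) ∂symMeasure =
      ∫ x, a₀ / 2 * Real.cos (k * x) ∂symMeasure + 1 / π * (π * cosCoeff F k) := by
    simp only [add_mul, mul_assoc (1 / π)]
    rw [integral_add h1 h2, integral_const_mul (1 / π), integral_mul_cos_mul F]
  rw [integral_mul_cos_mul] at h3
  have h4 : ∫ x, a₀ / 2 * Real.cos (k * x) ∂symMeasure = π * (if k = 0 then a₀ else 0) := by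
    split_ifs with h
    · subst h; simp only [Nat.cast_zero, zero_mul, Real.cos_zero, mul_one]
      rw [integral_const_symMeasure]; ring
    · rw [integral_const_mul]
      have := integral_cos_nat_mul_add (k := k) (by omega) 0
      simp only [add_zero] at this
      rw [this]; simp
  rw [h4] at h3
  have hpi := Real.pi_ne_zero
  field_simp at h3 ⊢
  linarith

theorem sinCoeff_affine_perConv (a₀ : ℝ) {F : ℝ → ℝ} (hF : MemPerLp 1 F) (k : ℕ) :
    sinCoeff (fun x => a₀ / 2 + 1 / π * F x) k = 1 / π * sinCoeff F k := by
  have h1 : Integrable (fun x : ℝ => a₀ / 2 * Real.sin (k * x)) symMeasure :=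
    Integrable.mul_sin_mul (f := fun _ => a₀ / 2) (integrable_const _) k
  have h2 : Integrable (fun x : ℝ => 1 / π * (F x * Real.sin (k * x))) symMeasure :=
    (Integrable.mul_sin_mul hF.integrable k).const_mul _
  have h3 : ∫ x, (a₀ / 2 + 1 / π * F x) * Real.sin (k * x) ∂symMeasure =
      ∫ x, a₀ / 2 * Real.sin (k * x) ∂symMeasure + 1 / π * (π * sinCoeff F k) := by
    simp only [add_mul, mul_assoc (1 / π)]
    rw [integral_add h1 h2, integral_const_mul (1 / π), integral_mul_sin_mul F]
  rw [integral_mul_sin_mul] at h3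
  have h4 : ∫ x, a₀ / 2 * Real.sin (k * x) ∂symMeasure = 0 := by
    rcases Nat.eq_zero_or_pos k with h | h
    · subst h; simp
    · rw [integral_const_mul]
      have := integral_cos_nat_mul_add h (-(π / 2))
      simp only [← sub_eq_add_neg, Real.cos_sub_pi_div_two] at this
      rw [this]; simp
  rw [h4] at h3
  have hpi := Real.pi_ne_zero
  field_simp at h3 ⊢
  linarith

/-- The deviation of the Fourier sum of `a₀/2 + (1/π) Ψ * φ` is `(1/π) (Ψ - S_m Ψ) * φ`. -/
theorem sub_fourierSum_ae {Ψ φ f : ℝ → ℝ} {a₀ : ℝ} (hΨ : MemPerLp 1 Ψ) (hφ : MemPerLp 1 φ)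
    (hf : f =ᵐ[symMeasure] fun x => a₀ / 2 + 1 / π * perConv Ψ φ x) (m : ℕ) :
    (fun x => f x - fourierSum m f x) =ᵐ[symMeasure]
      fun x => 1 / π * perConv (fun u => Ψ u - fourierSum m Ψ u) φ x := by
  have hS : MemPerLp 1 (fourierSum m Ψ) :=
    (continuous_fourierSum m Ψ).memPerLp_one (fourierSum_periodic m Ψ)
  filter_upwards [hf, perConv_sub_ae hΨ hS hφ] with x hx hx2
  rw [hx, hx2, perConv_fourierSum m hΨ hφ, fourierSum_congr hf]
  simp only [fourierSum, cosCoeff_affine_perConv a₀ (memPerLp_perConv hΨ hφ),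
    sinCoeff_affine_perConv a₀ (memPerLp_perConv hΨ hφ)]
  have : ∀ k ∈ Finset.Icc 1 m, ((if k = 0 then a₀ else 0) + 1 / π * cosCoeff (perConv Ψ φ) k) *
      Real.cos (k * x) + 1 / π * sinCoeff (perConv Ψ φ) k * Real.sin (k * x) =
      1 / π * (cosCoeff (perConv Ψ φ) k * Real.cos (k * x) +
        sinCoeff (perConv Ψ φ) k * Real.sin (k * x)) := by
    intro k hk
    have := (Finset.mem_Icc.1 hk).1
    rw [if_neg (by omega)]; ring
  rw [Finset.sum_congr rfl this, ← Finset.mul_sum, if_pos trivial]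
  ring

/-! ### Uniqueness of Fourier coefficients -/

theorem integral_mul_fourier_eq_zero {h : ℝ → ℝ} (hint : Integrable h symMeasure)
    (hc : ∀ k : ℕ, cosCoeff h k = 0) (hs : ∀ k : ℕ, sinCoeff h k = 0) (n : ℤ) :
    ∫ x, (h x : ℂ) * fourier n (x : AddCircle (2 * π)) ∂symMeasure = 0 := by
  have e : ∀ x : ℝ, (h x : ℂ) * fourier n (x : AddCircle (2 * π)) =
      ((h x * Real.cos (n * x) : ℝ) : ℂ) + Complex.I * ((h x * Real.sin (n * x) : ℝ) : ℂ) := by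
    intro x
    rw [fourier_coe_apply]
    have : 2 * (π : ℂ) * Complex.I * n * x / ((2 * π : ℝ) : ℂ) = ((n * x : ℝ) : ℂ) * Complex.I := by
      have : (π : ℂ) ≠ 0 := by exact_mod_cast Real.pi_ne_zero
      push_cast; field_simp
    rw [this, Complex.exp_mul_I, ← Complex.ofReal_cos, ← Complex.ofReal_sin]
    push_cast; ring
  have i1 : Integrable (fun x => ((h x * Real.cos (n * x) : ℝ) : ℂ)) symMeasure :=
    (Integrable.mul_cos_mul hint n).ofReal
  have i2 : Integrable (fun x => ((h x * Real.sin (n * x) : ℝ) : ℂ)) symMeasure :=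
    (Integrable.mul_sin_mul hint n).ofReal
  have z1 : ∫ x, h x * Real.cos (n * x) ∂symMeasure = 0 := by
    have := integral_mul_cos_mul h n.natAbs
    rw [hc, mul_zero] at this
    rw [← this]
    congr 1; ext x
    rcases Int.natAbs_eq n with hn | hn
    · rw [congrArg (Int.cast : ℤ → ℝ) hn]; simp
    · rw [congrArg (Int.cast : ℤ → ℝ) hn]; simp
  have z2 : ∫ x, h x * Real.sin (n * x) ∂symMeasure = 0 := by
    have := integral_mul_sin_mul h n.natAbs
    rw [hs, mul_zero] at this
    rcases Int.natAbs_eq n with hn | hn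
    · rw [← this]
      congr 1; ext x
      rw [congrArg (Int.cast : ℤ → ℝ) hn]; simp
    · rw [← neg_eq_zero, ← this, ← integral_neg]
      congr 1; ext x
      rw [congrArg (Int.cast : ℤ → ℝ) hn]; simp
  simp only [e]
  rw [integral_add i1 (i2.const_mul _), integral_const_mul, integral_complex_ofReal, integral_complex_ofReal, z1, z2]
  simp

/-- `F ↦ ∫ h F` is a functional on `C(AddCircle (2 * π), ℂ)` bounded by `‖h‖_1`; it vanishes on the
exponentials, whose span is dense. -/
theorem integral_mul_continuousMap_eq_zero {h : ℝ → ℝ} (hint : Integrable h symMeasure)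
    (hc : ∀ k : ℕ, cosCoeff h k = 0) (hs : ∀ k : ℕ, sinCoeff h k = 0)
    (F : C(AddCircle (2 * π), ℂ)) :
    ∫ x, (h x : ℂ) * F (x : AddCircle (2 * π)) ∂symMeasure = 0 := by
  have hI : ∀ F : C(AddCircle (2 * π), ℂ),
      Integrable (fun x : ℝ => (h x : ℂ) * F (x : AddCircle (2 * π))) symMeasure := by
    intro F
    refine hint.ofReal.mul_bdd (c := ‖F‖) ?_ (Eventually.of_forall fun x => F.norm_coe_le_norm _)
    exact (F.continuous.comp (AddCircle.continuous_mk' (2 * π))).aestronglyMeasurable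
  let Λ₀ : C(AddCircle (2 * π), ℂ) →ₗ[ℂ] ℂ :=
    { toFun := fun F => ∫ x, (h x : ℂ) * F (x : AddCircle (2 * π)) ∂symMeasure
      map_add' := fun F G => by
        rw [← integral_add (hI F) (hI G)]; simp [mul_add]
      map_smul' := fun c F => by
        simp only [ContinuousMap.smul_apply, smul_eq_mul, RingHom.id_apply]
        rw [← integral_const_mul]
        congr 1; ext x; ring }
  let Λ : C(AddCircle (2 * π), ℂ) →L[ℂ] ℂ :=
    Λ₀.mkContinuous (∫ x, ‖h x‖ ∂symMeasure) (fun F => by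
      refine (norm_integral_le_integral_norm _).trans ?_
      rw [← integral_mul_const]
      refine integral_mono (hI F).norm (hint.norm.mul_const _) fun x => ?_
      simp only [norm_mul, Complex.norm_real]
      gcongr
      exact F.norm_coe_le_norm _)
  have hd : Dense (Submodule.span ℂ (range (@fourier (2 * π))) : Set C(AddCircle (2 * π), ℂ)) :=
    Submodule.dense_iff_topologicalClosure_eq_top.2 span_fourier_closure_eq_top
  have : Λ = 0 := by
    refine ContinuousLinearMap.ext_on hd ?_
    rintro _ ⟨n, rfl⟩
    exact integral_mul_fourier_eq_zero hint hc hs n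
  exact DFunLike.congr_fun this F

/-- Uniqueness of Fourier coefficients of summable functions. -/
theorem ae_eq_zero_of_coeff_eq_zero {h : ℝ → ℝ} (hint : Integrable h symMeasure)
    (hc : ∀ k : ℕ, cosCoeff h k = 0) (hs : ∀ k : ℕ, sinCoeff h k = 0) : h =ᵐ[symMeasure] 0 := by
  have key : ∀ᵐ x : ℝ, x ∈ Ioo (-π) π → h x = 0 := by
    -- Test functions supported inside the open interval vanish at both ends, hence descend to
    -- continuous functions on the circle.
    refine isOpen_Ioo.ae_eq_zero_of_integral_contDiff_smul_eq_zero ?_ ?_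
    · have : IntegrableOn h (Ioo (-π) π) volume := IntegrableOn.mono_set hint Ioo_subset_Ioc_self
      exact this.locallyIntegrableOn
    · intro g hg _ hsup
      have hpi := Real.pi_pos
      have hz : ∀ x, x ∉ Ioo (-π) π → g x = 0 := fun x hx =>
        image_eq_zero_of_notMem_tsupport fun h' => hx (hsup h')
      have hper : (fun x => (g x : ℂ)) (-π) = (fun x => (g x : ℂ)) (-π + 2 * π) := by
        simp only
        rw [hz (-π) (by simp), hz (-π + 2 * π) (by simp; intro; linarith)]
      let F : C(AddCircle (2 * π), ℂ) :=
        ⟨AddCircle.liftIoc (2 * π) (-π) (fun x => (g x : ℂ)),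
          AddCircle.liftIoc_continuous hper
            (Complex.continuous_ofReal.comp hg.continuous).continuousOn⟩
      have := integral_mul_continuousMap_eq_zero hint hc hs F
      have e : ∫ x, (h x : ℂ) * F (x : AddCircle (2 * π)) ∂symMeasure =
          ((∫ x, g x * h x ∂symMeasure : ℝ) : ℂ) := by
        rw [← integral_complex_ofReal]
        refine setIntegral_congr_fun measurableSet_Ioc fun x hx => ?_
        have : F (x : AddCircle (2 * π)) = (g x : ℂ) :=
          AddCircle.liftIoc_coe_apply (f := fun x => (g x : ℂ))
            (by rwa [show -π + 2 * π = π by ring])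
        simp only [this]
        push_cast
        exact mul_comm _ _
      rw [e] at this
      have h0 : ∫ x, g x * h x ∂symMeasure = 0 := by exact_mod_cast this
      simp only [smul_eq_mul]
      rw [← h0, symMeasure]
      refine (setIntegral_eq_integral_of_forall_compl_eq_zero fun x hx => ?_).symm
      rw [hz x fun h' => hx (Ioo_subset_Ioc_self h'), zero_mul]
  rw [symMeasure, ← restrict_Ioo_eq_restrict_Ioc]
  exact (ae_restrict_iff' measurableSet_Ioo).2 key

theorem ae_eq_of_coeff_eq {f g : ℝ → ℝ} (hf : Integrable f symMeasure)
    (hg : Integrable g symMeasure) (hc : ∀ k : ℕ, cosCoeff f k = cosCoeff g k)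
    (hs : ∀ k : ℕ, sinCoeff f k = sinCoeff g k) : f =ᵐ[symMeasure] g := by
  have hsub : f - g =ᵐ[symMeasure] 0 := by
    refine ae_eq_zero_of_coeff_eq_zero (hf.sub hg) (fun k => ?_) (fun k => ?_)
    · have h1 := integral_sub (Integrable.mul_cos_mul hf k) (Integrable.mul_cos_mul hg k)
      rw [integral_mul_cos_mul, integral_mul_cos_mul, hc, sub_self] at h1
      simp only [← sub_mul] at h1
      have h2 := integral_mul_cos_mul (f - g) k
      simp only [Pi.sub_apply] at h2
      rw [h1] at h2
      exact (mul_eq_zero.1 h2.symm).resolve_left Real.pi_ne_zero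
    · have h1 := integral_sub (Integrable.mul_sin_mul hf k) (Integrable.mul_sin_mul hg k)
      rw [integral_mul_sin_mul, integral_mul_sin_mul, hs, sub_self] at h1
      simp only [← sub_mul] at h1
      have h2 := integral_mul_sin_mul (f - g) k
      simp only [Pi.sub_apply] at h2
      rw [h1] at h2
      exact (mul_eq_zero.1 h2.symm).resolve_left Real.pi_ne_zero
  filter_upwards [hsub] with x hx
  exact sub_eq_zero.1 hx

/-! ### Cosine sums, Abel summation and sums of powers -/

theorem abs_div_pi_le_abs_sin_half {x : ℝ} (hx : |x| ≤ π) : |x| / π ≤ |Real.sin (x / 2)| := by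
  have h := Real.mul_le_sin (x := |x| / 2) (by positivity) (by linarith)
  have h2 : |Real.sin (x / 2)| = |Real.sin (|x| / 2)| := by
    rcases abs_choice x with h | h
    · rw [h]
    · rw [h, neg_div, Real.sin_neg, abs_neg]
  rw [h2]
  refine le_trans (le_of_eq ?_) (h.trans (le_abs_self _))
  ring

theorem two_mul_sin_half_mul_sum_cos (x γ : ℝ) {a b : ℕ} (hab : a ≤ b) :
    2 * Real.sin (x / 2) * ∑ k ∈ Finset.Ico a b, Real.cos (k * x - γ) =
      Real.sin ((b - 1 / 2) * x - γ) - Real.sin ((a - 1 / 2) * x - γ) := by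
  induction b, hab using Nat.le_induction with
  | base => simp
  | succ b hab ih =>
    rw [Finset.sum_Ico_succ_top hab, mul_add, ih]
    have e1 : (((b + 1 : ℕ) : ℝ) - 1 / 2) * x - γ = (b * x - γ) + x / 2 := by push_cast; ring
    have e2 : ((b : ℝ) - 1 / 2) * x - γ = (b * x - γ) - x / 2 := by ring
    rw [e1, e2, Real.sin_add, Real.sin_sub]
    ring

/-- The sum times `2 sin(x/2)` telescopes to a difference of two sines, at most 2, while `|sin(x/2)|
≥ |x|/π`. -/
theorem abs_sum_cos_le {x : ℝ} (hx0 : x ≠ 0) (hx : |x| ≤ π) (γ : ℝ) {a b : ℕ} (hab : a ≤ b) :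
    |∑ k ∈ Finset.Ico a b, Real.cos (k * x - γ)| ≤ π / |x| := by
  have h := two_mul_sin_half_mul_sum_cos x γ hab
  have h1 := abs_div_pi_le_abs_sin_half hx
  have hxp : 0 < |x| := abs_pos.2 hx0
  have hpi := Real.pi_pos
  have h2 : |2 * Real.sin (x / 2) * ∑ k ∈ Finset.Ico a b, Real.cos (k * x - γ)| ≤ 2 := by
    rw [h]
    refine (abs_sub _ _).trans ?_
    linarith [Real.abs_sin_le_one ((b - 1 / 2) * x - γ), Real.abs_sin_le_one ((a - 1 / 2) * x - γ)]
  rw [abs_mul, abs_mul, abs_two] at h2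
  rw [le_div_iff₀ hxp]
  set S := |∑ k ∈ Finset.Ico a b, Real.cos (k * x - γ)|
  have hS : 0 ≤ S := abs_nonneg _
  have h3 : |x| / π * S ≤ 1 := by nlinarith
  rw [div_mul_eq_mul_div, div_le_one hpi] at h3
  linarith

/-- Abel's inequality for a nonincreasing nonnegative weight. -/
theorem abs_sum_mul_le_of_antitone {u c : ℕ → ℝ} {M : ℝ} {a b : ℕ} (hab : a ≤ b)
    (hu : ∀ k l, a ≤ k → k ≤ l → u l ≤ u k) (hu0 : ∀ k, a ≤ k → 0 ≤ u k)
    (hc : ∀ b, a ≤ b → |∑ k ∈ Finset.Ico a b, c k| ≤ M) :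
    |∑ k ∈ Finset.Ico a b, u k * c k| ≤ u a * M := by
  -- The left side is Abel's transform `∑ (u_k - u_{k+1}) S_{k+1}`, with nonnegative weights adding
  -- up to `u a - u b`.
  have key : |∑ k ∈ Finset.Ico a b, u k * c k - u b * ∑ k ∈ Finset.Ico a b, c k| ≤
      (u a - u b) * M := by
    induction b, hab using Nat.le_induction with
    | base => simp
    | succ b hab ih =>
      have hS := hc (b + 1) (by omega)
      have hd := hu b (b + 1) hab (by omega)
      have e : ∑ k ∈ Finset.Ico a (b + 1), u k * c k -
          u (b + 1) * ∑ k ∈ Finset.Ico a (b + 1), c k =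
          (∑ k ∈ Finset.Ico a b, u k * c k - u b * ∑ k ∈ Finset.Ico a b, c k) +
            (u b - u (b + 1)) * ∑ k ∈ Finset.Ico a (b + 1), c k := by
        rw [Finset.sum_Ico_succ_top hab, Finset.sum_Ico_succ_top hab]; ring
      rw [e]
      refine (abs_add_le _ _).trans ?_
      rw [abs_mul (u b - u (b + 1)), abs_of_nonneg (sub_nonneg.2 hd)]
      have := mul_le_mul_of_nonneg_left hS (sub_nonneg.2 hd)
      linarith
  have h1 := hc b hab
  have h0 := hu0 b hab
  have h2 : |u b * ∑ k ∈ Finset.Ico a b, c k| ≤ u b * M := by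
    rw [abs_mul, abs_of_nonneg h0]; gcongr
  calc |∑ k ∈ Finset.Ico a b, u k * c k|
      = |(∑ k ∈ Finset.Ico a b, u k * c k - u b * ∑ k ∈ Finset.Ico a b, c k) +
          u b * ∑ k ∈ Finset.Ico a b, c k| := by congr 1; ring
    _ ≤ (u a - u b) * M + u b * M := (abs_add_le _ _).trans (add_le_add key h2)
    _ = u a * M := by ring

/-- Discrete comparison with `∫ t^{-α}`: Bernoulli's inequality with exponent `1 - α` bounds each
term by an increment of `N^{1-α}/(1-α)`. -/
theorem sum_rpow_neg_le {α : ℝ} (h0 : 0 < α) (h1 : α < 1) (N : ℕ) :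
    ∑ k ∈ Finset.Ico 1 (N + 1), (k : ℝ) ^ (-α) ≤ (N : ℝ) ^ (1 - α) / (1 - α) := by
  have h1' : 0 < 1 - α := by linarith
  induction N with
  | zero => simp [Real.zero_rpow h1'.ne']
  | succ N ih =>
    rw [Finset.sum_Ico_succ_top (by omega)]
    have hk : (0 : ℝ) < ((N + 1 : ℕ) : ℝ) := by positivity
    set k : ℝ := ((N + 1 : ℕ) : ℝ) with hkdef
    have hN : (N : ℝ) = k * (1 + (-1 / k)) := by
      field_simp; rw [hkdef]; push_cast; ring
    have hb := rpow_one_add_le_one_add_mul_self (s := -1 / k) (p := 1 - α) (by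
      rw [neg_div, neg_le_neg_iff, div_le_one hk, hkdef]; push_cast; linarith [N.cast_nonneg (α := ℝ)])
      h1'.le (by linarith)
    have hb2 : (N : ℝ) ^ (1 - α) ≤ k ^ (1 - α) - (1 - α) * k ^ (-α) := by
      have hnn : 0 ≤ 1 + (-1 / k) := by
        have h := N.cast_nonneg (α := ℝ)
        rw [hN] at h
        exact nonneg_of_mul_nonneg_right h hk
      rw [hN, Real.mul_rpow hk.le hnn]
      have : k ^ (1 - α) * (1 / k) = k ^ (-α) := by
        rw [one_div, ← Real.rpow_neg_one, ← Real.rpow_add hk]; congr 1; ring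
      calc k ^ (1 - α) * (1 + -1 / k) ^ (1 - α) ≤ k ^ (1 - α) * (1 + (1 - α) * (-1 / k)) := by
            gcongr
        _ = k ^ (1 - α) - (1 - α) * (k ^ (1 - α) * (1 / k)) := by ring
        _ = _ := by rw [this]
    have : k ^ (-α) ≤ (k ^ (1 - α) - (N : ℝ) ^ (1 - α)) / (1 - α) := by
      rw [le_div_iff₀ h1']; linarith
    calc _ ≤ (N : ℝ) ^ (1 - α) / (1 - α) + (k ^ (1 - α) - (N : ℝ) ^ (1 - α)) / (1 - α) := by
          gcongr
      _ = _ := by ring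

/-- The same comparison with negative exponent `1 - α`, where `1 + z ≤ e^z` replaces Bernoulli. The
increment ending at `n` would start from `n - 1`, possibly 0, so the first term is kept apart; it
accounts for the summand 1 in the constant. -/
theorem sum_rpow_neg_tail_le {α : ℝ} (h1 : 1 < α) {n b : ℕ} (hn : 1 ≤ n) (hb : n ≤ b) :
    ∑ k ∈ Finset.Ico n b, (k : ℝ) ^ (-α) ≤ (1 + 1 / (α - 1)) * (n : ℝ) ^ (1 - α) := by
  have h1' : 0 < α - 1 := by linarith
  have step : ∀ N : ℕ, 1 ≤ N →
      ((N + 1 : ℕ) : ℝ) ^ (-α) ≤ ((N : ℝ) ^ (1 - α) - ((N + 1 : ℕ) : ℝ) ^ (1 - α)) / (α - 1) := by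
    intro N hN
    have hN0 : (0 : ℝ) < N := by exact_mod_cast hN
    have hk : (0 : ℝ) < ((N + 1 : ℕ) : ℝ) := by positivity
    set k : ℝ := ((N + 1 : ℕ) : ℝ) with hkdef
    have hN : (N : ℝ) = k * (1 - 1 / k) := by
      field_simp; rw [hkdef]; push_cast; ring
    have hpos : 0 < 1 - 1 / k := by
      rw [hN] at hN0; exact pos_of_mul_pos_right hN0 hk.le
    have hexp : 1 - 1 / k ≤ Real.exp (-(1 / k)) := by
      have := Real.add_one_le_exp (-(1 / k)); linarith
    have h2 : 1 + (α - 1) / k ≤ (1 - 1 / k) ^ (1 - α) := by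
      have h3 : Real.exp (-(1 / k)) ^ (1 - α) ≤ (1 - 1 / k) ^ (1 - α) :=
        Real.rpow_le_rpow_of_nonpos hpos hexp (by linarith)
      rw [← Real.exp_mul] at h3
      have h4 := Real.add_one_le_exp (-(1 / k) * (1 - α))
      have e : -(1 / k) * (1 - α) = (α - 1) / k := by ring
      rw [e] at h3 h4
      linarith
    rw [le_div_iff₀ h1', hN, Real.mul_rpow hk.le hpos.le]
    have : k ^ (1 - α) * (1 / k) = k ^ (-α) := by
      rw [one_div, ← Real.rpow_neg_one, ← Real.rpow_add hk]; congr 1; ring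
    have h5 := mul_le_mul_of_nonneg_left h2 (Real.rpow_nonneg hk.le (1 - α))
    have e2 : k ^ (1 - α) * (1 + (α - 1) / k) = k ^ (1 - α) + (α - 1) * (k ^ (1 - α) * (1 / k)) := by
      ring
    rw [e2, this] at h5
    linarith
  have hnp : (0 : ℝ) < n := by exact_mod_cast hn
  have key : ∀ b, n + 1 ≤ b → ∑ k ∈ Finset.Ico n b, (k : ℝ) ^ (-α) ≤
      (n : ℝ) ^ (-α) + ((n : ℝ) ^ (1 - α) - ((b - 1 : ℕ) : ℝ) ^ (1 - α)) / (α - 1) := by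
    intro b hb
    induction b, hb using Nat.le_induction with
    | base => simp
    | succ b hb ih =>
      obtain ⟨m, rfl⟩ : ∃ m, b = m + 1 := ⟨b - 1, by omega⟩
      rw [Finset.sum_Ico_succ_top (by omega)]
      have := step m (by omega)
      simp only [Nat.add_sub_cancel] at ih ⊢
      calc _ ≤ _ := add_le_add ih this
        _ = _ := by ring
  have hle : (n : ℝ) ^ (-α) ≤ (n : ℝ) ^ (1 - α) :=
    Real.rpow_le_rpow_of_exponent_le (by exact_mod_cast hn) (by linarith)
  rcases hb.eq_or_lt with rfl | hlt
  · simp; positivity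
  · refine (key b hlt).trans ?_
    have : 0 ≤ ((b - 1 : ℕ) : ℝ) ^ (1 - α) := by positivity
    rw [sub_div, add_mul, one_mul, one_div_mul_eq_div]
    have : 0 ≤ ((b - 1 : ℕ) : ℝ) ^ (1 - α) / (α - 1) := by positivity
    linarith

/-! ### Almost decreasing sequences and bounds for blocks of their cosine series -/

/-- A positive nonincreasing sequence `u` such that `k ^ α u k` is almost decreasing with
constant `K`. -/
structure AlmostDecreasing (u : ℕ → ℝ) (α K : ℝ) : Prop where
  anti : ∀ m k : ℕ, 1 ≤ m → m ≤ k → u k ≤ u m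
  pos : ∀ k : ℕ, 1 ≤ k → 0 < u k
  rpow_le : ∀ m k : ℕ, 1 ≤ m → m ≤ k → (k : ℝ) ^ α * u k ≤ K * ((m : ℝ) ^ α * u m)
  const_pos : 0 < K

theorem AlmostDecreasing.le_rpow {u : ℕ → ℝ} {α K : ℝ} (h : AlmostDecreasing u α K) {m k : ℕ}
    (hm : 1 ≤ m) (hk : m ≤ k) : u k ≤ K * u m * (m : ℝ) ^ α * (k : ℝ) ^ (-α) := by
  have hk0 : (0 : ℝ) < k := by exact_mod_cast (by omega : 0 < k)
  rw [Real.rpow_neg hk0.le, ← div_eq_mul_inv, le_div_iff₀ (Real.rpow_pos_of_pos hk0 _)]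
  linarith [h.rpow_le m k hm hk]

/-- The factor `k^{α'-α}` is nonincreasing. This brings exponents into `(0, 1)`, where the pointwise
estimates work. -/
theorem AlmostDecreasing.mono {u : ℕ → ℝ} {α α' K : ℝ} (h : AlmostDecreasing u α K)
    (hα : α' ≤ α) : AlmostDecreasing u α' K where
  anti := h.anti
  pos := h.pos
  const_pos := h.const_pos
  rpow_le := by
    intro m k hm hk
    have hk0 : (0 : ℝ) < k := by exact_mod_cast (by omega : 0 < k)
    have hm0 : (0 : ℝ) < m := by exact_mod_cast hm
    have hK := h.const_pos
    have hu := h.pos m hm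
    have e1 : (k : ℝ) ^ α' = (k : ℝ) ^ (α' - α) * (k : ℝ) ^ α := by
      rw [← Real.rpow_add hk0]; congr 1; ring
    have e2 : (m : ℝ) ^ α' = (m : ℝ) ^ (α' - α) * (m : ℝ) ^ α := by
      rw [← Real.rpow_add hm0]; congr 1; ring
    have h3 : (k : ℝ) ^ (α' - α) ≤ (m : ℝ) ^ (α' - α) :=
      Real.rpow_le_rpow_of_nonpos hm0 (by exact_mod_cast hk) (by linarith)
    rw [e1, e2, mul_assoc]
    calc (k : ℝ) ^ (α' - α) * ((k : ℝ) ^ α * u k)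
        ≤ (m : ℝ) ^ (α' - α) * (K * ((m : ℝ) ^ α * u m)) :=
          mul_le_mul h3 (h.rpow_le m k hm hk) (mul_nonneg (by positivity) (h.pos k (by omega)).le)
            (by positivity)
      _ = _ := by ring

theorem AlmostDecreasing.abs_sum_le {u : ℕ → ℝ} {α K : ℝ} (h : AlmostDecreasing u α K)
    {n b : ℕ} (hn : 1 ≤ n) (hb : n ≤ b) {x : ℝ} (hx0 : x ≠ 0) (hx : |x| ≤ π) (γ : ℝ) :
    |∑ k ∈ Finset.Ico n b, u k * Real.cos (k * x - γ)| ≤ u n * (π / |x|) :=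
  abs_sum_mul_le_of_antitone hb (fun k l hk hl => h.anti k l (by omega) hl)
    (fun k hk => (h.pos k (by omega)).le) (fun _ hb' => abs_sum_cos_le hx0 hx γ hb')

theorem AlmostDecreasing.sum_le {u : ℕ → ℝ} {α K : ℝ} (h : AlmostDecreasing u α K)
    (hα0 : 0 < α) (hα1 : α < 1) {n N : ℕ} (hn : 1 ≤ n) :
    ∑ k ∈ Finset.Ico n (N + 1), u k ≤ K * u n * (n : ℝ) ^ α * ((N : ℝ) ^ (1 - α) / (1 - α)) := by
  have hc : 0 ≤ K * u n * (n : ℝ) ^ α := by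
    have := h.const_pos
    have := h.pos n hn
    positivity
  calc ∑ k ∈ Finset.Ico n (N + 1), u k
      ≤ ∑ k ∈ Finset.Ico n (N + 1), K * u n * (n : ℝ) ^ α * (k : ℝ) ^ (-α) :=
        Finset.sum_le_sum fun k hk => h.le_rpow hn (Finset.mem_Ico.1 hk).1
    _ = K * u n * (n : ℝ) ^ α * ∑ k ∈ Finset.Ico n (N + 1), (k : ℝ) ^ (-α) := by
        rw [Finset.mul_sum]
    _ ≤ K * u n * (n : ℝ) ^ α * ∑ k ∈ Finset.Ico 1 (N + 1), (k : ℝ) ^ (-α) := by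
        gcongr
    _ ≤ _ := by gcongr; exact sum_rpow_neg_le hα0 hα1 N

/-- If `n|x| ≥ 1`, Abel's bound suffices, since `(n|x|)^α ≥ 1`. Otherwise cut at `N = ⌊1/|x|⌋`: up
to `N`, absolute values and `N^{1-α} ≤ |x|^{α-1}`; beyond, Abel's bound with `u (N+1) ≤ K u_n n^α
|x|^α`. The three cases produce `π`, `K/(1-α)` and `Kπ`. -/
theorem AlmostDecreasing.abs_sum_le_rpow {u : ℕ → ℝ} {α K : ℝ} (h : AlmostDecreasing u α K)
    (hα0 : 0 < α) (hα1 : α < 1)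
    {n b : ℕ} (hn : 1 ≤ n) (hb : n ≤ b) {x : ℝ} (hx0 : x ≠ 0) (hx : |x| ≤ π) (γ : ℝ) :
    |∑ k ∈ Finset.Ico n b, u k * Real.cos (k * x - γ)| ≤
      (K * (1 / (1 - α) + π) + π) * (u n * (n : ℝ) ^ α * |x| ^ (α - 1)) := by
  have hxp : 0 < |x| := abs_pos.2 hx0
  have hn0 : (0 : ℝ) < n := by exact_mod_cast hn
  have hu := h.pos n hn
  have hK := h.const_pos
  have hpi := Real.pi_pos
  have h1α : 0 < 1 - α := by linarith
  set Q := u n * (n : ℝ) ^ α * |x| ^ (α - 1) with hQ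
  have hQ0 : 0 < Q := by positivity
  have hxe : |x| ^ (α - 1) = |x| ^ α * |x|⁻¹ := by
    rw [← Real.rpow_neg_one, ← Real.rpow_add hxp]; rfl
  rcases le_or_gt 1 (n * |x|) with hcase | hcase
  · refine (h.abs_sum_le hn hb hx0 hx γ).trans ?_
    have h1 : 1 ≤ (n : ℝ) ^ α * |x| ^ α := by
      rw [← Real.mul_rpow hn0.le hxp.le]
      exact Real.one_le_rpow hcase hα0.le
    have h2 : u n * (π / |x|) ≤ π * Q := by
      rw [hQ, hxe, div_eq_mul_inv]
      calc u n * (π * |x|⁻¹) = π * (u n * |x|⁻¹) * 1 := by ring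
        _ ≤ π * (u n * |x|⁻¹) * ((n : ℝ) ^ α * |x| ^ α) := by gcongr
        _ = _ := by ring
    have : 0 ≤ K * (1 / (1 - α) + π) * Q := by positivity
    linarith
  · set N := ⌊1 / |x|⌋₊ with hN
    have hN1 : (N : ℝ) ≤ 1 / |x| := Nat.floor_le (by positivity)
    have hN2 : 1 / |x| < N + 1 := Nat.lt_floor_add_one _
    have hnN : n ≤ N := by
      apply Nat.le_floor
      rw [le_div_iff₀ hxp]; exact hcase.le
    have first : ∀ b' ≤ N + 1, |∑ k ∈ Finset.Ico n b', u k * Real.cos (k * x - γ)| ≤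
        K * (1 / (1 - α)) * Q := by
      intro b' hb'
      calc |∑ k ∈ Finset.Ico n b', u k * Real.cos (k * x - γ)|
          ≤ ∑ k ∈ Finset.Ico n b', u k := by
            refine (Finset.abs_sum_le_sum_abs _ _).trans (Finset.sum_le_sum fun k hk => ?_)
            have hk' := h.pos k (hn.trans (Finset.mem_Ico.1 hk).1)
            rw [abs_mul, abs_of_pos hk']
            exact mul_le_of_le_one_right hk'.le (Real.abs_cos_le_one _)
        _ ≤ ∑ k ∈ Finset.Ico n (N + 1), u k :=
            Finset.sum_le_sum_of_subset_of_nonneg (Finset.Ico_subset_Ico_right hb')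
              fun k hk _ => (h.pos k (hn.trans (Finset.mem_Ico.1 hk).1)).le
        _ ≤ K * u n * (n : ℝ) ^ α * ((N : ℝ) ^ (1 - α) / (1 - α)) := h.sum_le hα0 hα1 hn
        _ ≤ K * u n * (n : ℝ) ^ α * ((1 / |x|) ^ (1 - α) / (1 - α)) := by gcongr
        _ = K * (1 / (1 - α)) * Q := by
            rw [one_div |x|, Real.inv_rpow hxp.le, ← Real.rpow_neg hxp.le, neg_sub, hQ]; ring
    rcases le_total b (N + 1) with hbN | hbN
    · refine (first b hbN).trans ?_
      have : 0 ≤ (K * π + π) * Q := by positivity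
      linarith
    · rw [← Finset.sum_Ico_consecutive _ (show n ≤ N + 1 by omega) hbN]
      refine (abs_add_le _ _).trans ?_
      have h2 := h.abs_sum_le (show 1 ≤ N + 1 by omega) hbN hx0 hx γ
      have h3 := h.le_rpow hn (show n ≤ N + 1 by omega)
      have h4 : (((N + 1 : ℕ) : ℝ)) ^ (-α) ≤ |x| ^ α := by
        have : |x| ^ α = (1 / |x|) ^ (-α) := by
          rw [one_div, Real.inv_rpow hxp.le, ← Real.rpow_neg hxp.le, neg_neg]
        rw [this]
        refine Real.rpow_le_rpow_of_nonpos (by positivity) ?_ (by linarith)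
        push_cast; exact hN2.le
      have h5 : u (N + 1) * (π / |x|) ≤ K * π * Q := by
        calc u (N + 1) * (π / |x|)
            ≤ K * u n * (n : ℝ) ^ α * |x| ^ α * (π / |x|) := by
              gcongr
              exact h3.trans (by gcongr)
          _ = K * π * Q := by rw [hQ, hxe]; ring
      have := first (N + 1) le_rfl
      have : 0 ≤ π * Q := by positivity
      linarith

/-- For `α > 1` the series converges absolutely and no cancellation is needed; this serves `p = ∞`.
-/
theorem AlmostDecreasing.abs_sum_le_of_one_lt {u : ℕ → ℝ} {α K : ℝ} (h : AlmostDecreasing u α K)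
    (hα : 1 < α) {n b : ℕ} (hn : 1 ≤ n) (hb : n ≤ b) (x γ : ℝ) :
    |∑ k ∈ Finset.Ico n b, u k * Real.cos (k * x - γ)| ≤ K * (1 + 1 / (α - 1)) * (u n * n) := by
  have hn0 : (0 : ℝ) < n := by exact_mod_cast hn
  have hc : 0 ≤ K * u n * (n : ℝ) ^ α := by
    have := h.const_pos
    have := h.pos n hn
    positivity
  calc |∑ k ∈ Finset.Ico n b, u k * Real.cos (k * x - γ)|
      ≤ ∑ k ∈ Finset.Ico n b, u k := by
        refine (Finset.abs_sum_le_sum_abs _ _).trans (Finset.sum_le_sum fun k hk => ?_)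
        have hk' := h.pos k (hn.trans (Finset.mem_Ico.1 hk).1)
        rw [abs_mul, abs_of_pos hk']
        exact mul_le_of_le_one_right hk'.le (Real.abs_cos_le_one _)
    _ ≤ ∑ k ∈ Finset.Ico n b, K * u n * (n : ℝ) ^ α * (k : ℝ) ^ (-α) :=
        Finset.sum_le_sum fun k hk => h.le_rpow hn (Finset.mem_Ico.1 hk).1
    _ = K * u n * (n : ℝ) ^ α * ∑ k ∈ Finset.Ico n b, (k : ℝ) ^ (-α) := by rw [Finset.mul_sum]
    _ ≤ K * u n * (n : ℝ) ^ α * ((1 + 1 / (α - 1)) * (n : ℝ) ^ (1 - α)) := by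
        gcongr; exact sum_rpow_neg_tail_le hα hn hb
    _ = K * (1 + 1 / (α - 1)) * (u n * ((n : ℝ) ^ α * (n : ℝ) ^ (1 - α))) := by ring
    _ = _ := by rw [← Real.rpow_add hn0, add_sub_cancel, Real.rpow_one]

/-! ### The kernel as a pointwise sum, its envelope and its coefficients -/

/-- The partial sums `∑_{k=1}^{N} u k cos(k x - γ)`. -/
noncomputable def kerSum (u : ℕ → ℝ) (γ : ℝ) (N : ℕ) (x : ℝ) : ℝ :=
  ∑ k ∈ Finset.Ico 1 (N + 1), u k * Real.cos (k * x - γ)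

/-- The pointwise sum of the series `∑_{k ≥ 1} u k cos(k x - γ)`. -/
noncomputable def kerLim (u : ℕ → ℝ) (γ : ℝ) (x : ℝ) : ℝ :=
  limUnder atTop fun N => kerSum u γ N x

theorem continuous_kerSum (u : ℕ → ℝ) (γ : ℝ) (N : ℕ) : Continuous (kerSum u γ N) := by
  unfold kerSum; fun_prop

theorem kerSum_periodic (u : ℕ → ℝ) (γ : ℝ) (N : ℕ) :
    Function.Periodic (kerSum u γ N) (2 * π) := by
  intro x
  refine Finset.sum_congr rfl fun k _ => ?_
  have := cos_affine_periodic k (-γ) x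
  simp only [← sub_eq_add_neg] at this
  rw [this]

/-- True even where the series diverges: the value of `limUnder` depends only on the sequence of
partial sums. -/
theorem kerLim_periodic (u : ℕ → ℝ) (γ : ℝ) : Function.Periodic (kerLim u γ) (2 * π) := by
  intro x
  simp only [kerLim, fun N => kerSum_periodic u γ N x]

theorem kerSum_sub_kerSum (u : ℕ → ℝ) (γ x : ℝ) {n N : ℕ} (hn : 1 ≤ n) (hN : n ≤ N + 1) :
    kerSum u γ N x - kerSum u γ (n - 1) x =
      ∑ k ∈ Finset.Ico n (N + 1), u k * Real.cos (k * x - γ) := by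
  rw [kerSum, kerSum, Nat.sub_add_cancel hn, ← Finset.sum_Ico_consecutive _ hn hN]
  ring

theorem AlmostDecreasing.tendsto_zero {u : ℕ → ℝ} {α K : ℝ} (h : AlmostDecreasing u α K)
    (hα : 0 < α) : Tendsto u atTop (𝓝 0) := by
  have h1 : Tendsto (fun k : ℕ => K * u 1 * ((1 : ℕ) : ℝ) ^ α * (k : ℝ) ^ (-α)) atTop (𝓝 0) := by
    have := ((tendsto_rpow_neg_atTop hα).comp tendsto_natCast_atTop_atTop).const_mul
      (K * u 1 * ((1 : ℕ) : ℝ) ^ α)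
    simpa using this
  refine tendsto_of_tendsto_of_tendsto_of_le_of_le' tendsto_const_nhds h1 ?_ ?_
  · filter_upwards [eventually_ge_atTop 1] with k hk using (h.pos k hk).le
  · filter_upwards [eventually_ge_atTop 1] with k hk using h.le_rpow le_rfl hk

theorem AlmostDecreasing.tendsto_kerSum {u : ℕ → ℝ} {α K : ℝ} (h : AlmostDecreasing u α K)
    (hα : 0 < α) {x : ℝ} (hx0 : x ≠ 0) (hx : |x| ≤ π) (γ : ℝ) :
    Tendsto (fun N => kerSum u γ N x) atTop (𝓝 (kerLim u γ x)) := by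
  refine CauchySeq.tendsto_limUnder ?_
  refine cauchySeq_of_le_tendsto_0' (fun N => u (N + 1) * (π / |x|)) ?_ ?_
  · intro n m hnm
    rw [dist_comm, Real.dist_eq]
    have := kerSum_sub_kerSum u γ x (n := n + 1) (N := m) (by omega) (by omega)
    rw [Nat.add_sub_cancel] at this
    rw [this]
    exact h.abs_sum_le (by omega) (by omega) hx0 hx γ
  · have := ((h.tendsto_zero hα).comp (tendsto_add_atTop_nat 1)).mul_const (π / |x|)
    simpa using this

theorem symMeasure_ae : ∀ᵐ x ∂symMeasure, x ≠ 0 ∧ |x| ≤ π := by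
  have h1 : ∀ᵐ x ∂symMeasure, x ≠ 0 :=
    (Measure.absolutelyContinuous_of_le Measure.restrict_le_self).ae_le
      (Measure.ae_ne (volume : Measure ℝ) 0)
  filter_upwards [h1, ae_restrict_mem measurableSet_Ioc] with x hx hx2
  exact ⟨hx, abs_le.2 ⟨hx2.1.le, hx2.2⟩⟩

theorem AlmostDecreasing.abs_kerLim_sub_le {u : ℕ → ℝ} {α K : ℝ} (h : AlmostDecreasing u α K)
    (hα : 0 < α) {x : ℝ} (hx0 : x ≠ 0) (hx : |x| ≤ π) (γ : ℝ) {n : ℕ} (hn : 1 ≤ n) {B : ℝ}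
    (hB : ∀ b, n ≤ b → |∑ k ∈ Finset.Ico n b, u k * Real.cos (k * x - γ)| ≤ B) :
    |kerLim u γ x - kerSum u γ (n - 1) x| ≤ B := by
  have h1 := ((h.tendsto_kerSum hα hx0 hx γ).sub_const (kerSum u γ (n - 1) x)).abs
  refine le_of_tendsto h1 ?_
  filter_upwards [eventually_ge_atTop n] with N hN
  rw [kerSum_sub_kerSum u γ x hn (by omega)]
  exact hB _ (by omega)

/-- The envelope `|y|^{α-1}` for `|y| ≤ 1`, `|y|^{-1}` for `|y| > 1`. -/
noncomputable def envelope (α y : ℝ) : ℝ := if |y| ≤ 1 then |y| ^ (α - 1) else |y|⁻¹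

theorem measurable_envelope (α : ℝ) : Measurable (envelope α) := by
  unfold envelope
  refine Measurable.ite (measurableSet_le (by fun_prop) (by fun_prop)) ?_ ?_ <;> fun_prop

/-- Near 0 the `p`-th power is `|y|^{(α-1)p}`, integrable by `hα`; at infinity it is `|y|^{-p}` with
`p > 1`. -/
theorem memLp_envelope {α : ℝ} {p : ℝ≥0∞} (hp : 1 < p) (hpt : p ≠ ∞)
    (hα : -1 < (α - 1) * p.toReal) : MemLp (envelope α) p volume := by
  have hp0 : p ≠ 0 := (zero_lt_one.trans hp).ne'
  have hq : 1 < p.toReal := by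
    have := (ENNReal.toReal_lt_toReal (by simp) hpt).2 hp
    simpa using this
  rw [← integrable_norm_rpow_iff (measurable_envelope α).aestronglyMeasurable hp0 hpt]
  set q := p.toReal
  set f : ℝ → ℝ := fun x => ‖envelope α x‖ ^ q with hf
  have hfneg : ∀ x, f (-x) = f x := by intro x; simp [hf, envelope]
  have h1 : IntegrableOn f (Ioc 0 1) := by
    have := (intervalIntegrable_iff_integrableOn_Ioc_of_le zero_le_one).1
      (intervalIntegral.intervalIntegrable_rpow' (a := 0) (b := 1) hα)
    refine this.congr_fun (fun x hx => ?_) measurableSet_Ioc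
    have hx0 : 0 < x := hx.1
    simp only [hf, envelope, abs_of_pos hx0, if_pos hx.2, Real.norm_eq_abs,
      abs_of_nonneg (Real.rpow_nonneg hx0.le _)]
    rw [Real.rpow_mul hx0.le]
  have h2 : IntegrableOn f (Ioi 1) := by
    have := integrableOn_Ioi_rpow_of_lt (a := -q) (by linarith) zero_lt_one
    refine this.congr_fun (fun x hx => ?_) measurableSet_Ioi
    have hx1 : 1 < x := hx
    have hx0 : 0 < x := by linarith
    simp only [hf, envelope, abs_of_pos hx0, if_neg (not_le.2 hx1), Real.norm_eq_abs,
      abs_of_nonneg (inv_nonneg.2 hx0.le)]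
    rw [Real.inv_rpow hx0.le, Real.rpow_neg hx0.le]
  have h3 : IntegrableOn f (Ioi 0) := by
    rw [← Ioc_union_Ioi_eq_Ioi zero_le_one]; exact h1.union h2
  have h4 : IntegrableOn f (Iio 0) := by
    have := (Measure.measurePreserving_neg (volume : Measure ℝ)).integrableOn_comp_preimage
      (Homeomorph.neg ℝ).measurableEmbedding (f := f) (s := Ioi 0)
    have h5 := this.2 h3
    have e : (Neg.neg : ℝ → ℝ) ⁻¹' Ioi 0 = Iio 0 := by ext x; simp
    rw [e] at h5
    exact h5.congr_fun (fun x _ => hfneg x) measurableSet_Iio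
  have h6 : IntegrableOn f (Iic 0) := (integrableOn_Iic_iff_integrableOn_Iio).2 h4
  rw [← integrableOn_univ, ← Iic_union_Ioi (a := (0 : ℝ))]
  exact h6.union h3

/-- Both pointwise bounds become `u_n n` times a function of `y = n x` alone, so that `L_p` norms
follow by scaling. -/
theorem AlmostDecreasing.abs_sum_le_envelope {u : ℕ → ℝ} {α K : ℝ} (h : AlmostDecreasing u α K)
    (hα0 : 0 < α) (hα1 : α < 1)
    {n b : ℕ} (hn : 1 ≤ n) (hb : n ≤ b) {x : ℝ} (hx0 : x ≠ 0) (hx : |x| ≤ π) (γ : ℝ) :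
    |∑ k ∈ Finset.Ico n b, u k * Real.cos (k * x - γ)| ≤
      (K * (1 / (1 - α) + π) + π) * (u n * n) * envelope α (n * x) := by
  have hxp : 0 < |x| := abs_pos.2 hx0
  have hn0 : (0 : ℝ) < n := by exact_mod_cast hn
  have hu := h.pos n hn
  have hK := h.const_pos
  have hpi := Real.pi_pos
  have h1α : 0 < 1 - α := by linarith
  have habs : |(n : ℝ) * x| = n * |x| := by rw [abs_mul, abs_of_pos hn0]
  unfold envelope
  split_ifs with hc
  · refine (h.abs_sum_le_rpow hα0 hα1 hn hb hx0 hx γ).trans (le_of_eq ?_)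
    rw [habs, Real.mul_rpow hn0.le hxp.le]
    have : (n : ℝ) ^ α = n * (n : ℝ) ^ (α - 1) := by
      rw [Real.rpow_sub_one hn0.ne']; field_simp
    rw [this]; ring
  · refine (h.abs_sum_le hn hb hx0 hx γ).trans ?_
    rw [habs]
    have e : u n * (π / |x|) = π * (u n * n) * (n * |x|)⁻¹ := by field_simp
    rw [e]
    gcongr
    have : 0 ≤ K * (1 / (1 - α) + π) := by positivity
    linarith

/-- The tail `1/|y|` is not integrable on the line, so one passes through `L_q(ℝ)` with `q = 1/(1 -
α/2) > 1`, for which `(α-1)q > -1`, and then uses that the period has finite measure. -/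
theorem integrable_envelope {α : ℝ} (hα0 : 0 < α) (hα1 : α < 1) :
    Integrable (envelope α) symMeasure := by
  have h : 0 < 1 - α / 2 := by linarith
  have hq : 1 < 1 / (1 - α / 2) := by rw [lt_div_iff₀ h]; linarith
  have h1 : MemLp (envelope α) (ENNReal.ofReal (1 / (1 - α / 2))) volume := by
    refine memLp_envelope (by simpa using (ENNReal.ofReal_lt_ofReal_iff (by positivity)).2 hq)
      ENNReal.ofReal_ne_top ?_
    rw [ENNReal.toReal_ofReal (by positivity), mul_one_div, lt_div_iff₀ h]
    linarith
  have h2 : MemLp (envelope α) (ENNReal.ofReal (1 / (1 - α / 2))) symMeasure :=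
    h1.mono_measure Measure.restrict_le_self
  rw [← memLp_one_iff_integrable]
  refine h2.mono_exponent ?_
  rw [ENNReal.one_le_ofReal]; exact hq.le

theorem AlmostDecreasing.abs_kerSum_le {u : ℕ → ℝ} {α K : ℝ} (h : AlmostDecreasing u α K)
    (hα0 : 0 < α) (hα1 : α < 1) {x : ℝ} (hx0 : x ≠ 0) (hx : |x| ≤ π) (γ : ℝ) (N : ℕ) :
    |kerSum u γ N x| ≤ (K * (1 / (1 - α) + π) + π) * u 1 * envelope α x := by
  have := h.abs_sum_le_envelope hα0 hα1 le_rfl (show 1 ≤ N + 1 by omega) hx0 hx γ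
  simpa [kerSum] using this

theorem aestronglyMeasurable_kerLim {u : ℕ → ℝ} {α K : ℝ} (h : AlmostDecreasing u α K)
    (hα0 : 0 < α) (γ : ℝ) : AEStronglyMeasurable (kerLim u γ) symMeasure :=
  aestronglyMeasurable_of_tendsto_ae atTop
    (fun N => (continuous_kerSum u γ N).aestronglyMeasurable)
    (symMeasure_ae.mono fun _ hx => h.tendsto_kerSum hα0 hx.1 hx.2 γ)

theorem memPerLp_kerLim {u : ℕ → ℝ} {α K : ℝ} (h : AlmostDecreasing u α K)
    (hα0 : 0 < α) (hα1 : α < 1) (γ : ℝ) : MemPerLp 1 (kerLim u γ) := by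
  rw [memPerLp_one_iff (kerLim_periodic u γ)]
  refine ((integrable_envelope hα0 hα1).const_mul ((K * (1 / (1 - α) + π) + π) * u 1)).mono'
    (aestronglyMeasurable_kerLim h hα0 γ) ?_
  filter_upwards [symMeasure_ae] with x hx
  exact le_of_tendsto (h.tendsto_kerSum hα0 hx.1 hx.2 γ).abs
    (Eventually.of_forall fun N => h.abs_kerSum_le hα0 hα1 hx.1 hx.2 γ N)

theorem integral_cos_mul_cos {l : ℕ} (hl : 1 ≤ l) (k : ℕ) (γ c : ℝ) :
    ∫ x, Real.cos (l * x - γ) * Real.cos (k * x + c) ∂symMeasure =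
      if l = k then π * Real.cos (γ + c) else 0 := by
  have e : ∀ x : ℝ, Real.cos (l * x - γ) * Real.cos (k * x + c) =
      1 / 2 * (Real.cos (((l - k : ℤ) : ℝ) * x + (-γ - c)) +
        Real.cos (((l + k : ℤ) : ℝ) * x + (c - γ))) := by
    intro x
    rw [Real.cos_add_cos]
    push_cast
    rw [show (((l : ℝ) - k) * x + (-γ - c) + ((l + k) * x + (c - γ))) / 2 = l * x - γ by ring,
      show (((l : ℝ) - k) * x + (-γ - c) - ((l + k) * x + (c - γ))) / 2 = -(k * x + c) by ring,
      Real.cos_neg]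
    ring
  have hi : ∀ a b : ℝ, Integrable (fun x : ℝ => Real.cos (a * x + b)) symMeasure := by
    intro a b
    simpa using Integrable.mul_cos_affine (f := fun _ => (1 : ℝ)) (μ := symMeasure)
      (integrable_const _) a b
  simp only [e]
  rw [integral_const_mul, integral_add (hi _ _) (hi _ _),
    integral_cos_int_mul_add (l := (l + k : ℤ)) (by omega), add_zero]
  split_ifs with hlk
  · subst hlk
    simp only [sub_self, Int.cast_zero, zero_mul, zero_add]
    rw [integral_const_symMeasure, ← Real.cos_neg]
    ring_nf
  · rw [integral_cos_int_mul_add (l := (l - k : ℤ)) (by omega), mul_zero]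

theorem integral_kerSum_mul_cos (u : ℕ → ℝ) (γ c : ℝ) (N k : ℕ) :
    ∫ x, kerSum u γ N x * Real.cos (k * x + c) ∂symMeasure =
      if 1 ≤ k ∧ k ≤ N then π * (u k * Real.cos (γ + c)) else 0 := by
  have hi : ∀ l ∈ Finset.Ico 1 (N + 1), Integrable (fun x : ℝ =>
      u l * (Real.cos (l * x - γ) * Real.cos (k * x + c))) symMeasure := by
    intro l _
    refine Integrable.const_mul (Integrable.mul_cos_affine ?_ k c) _
    simpa [sub_eq_add_neg] using Integrable.mul_cos_affine (f := fun _ => (1 : ℝ)) (μ := symMeasure)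
      (integrable_const _) l (-γ)
  simp only [kerSum, Finset.sum_mul, mul_assoc]
  rw [integral_finsetSum _ hi]
  have : ∀ l ∈ Finset.Ico 1 (N + 1),
      ∫ x, u l * (Real.cos (l * x - γ) * Real.cos (k * x + c)) ∂symMeasure =
        if l = k then π * (u k * Real.cos (γ + c)) else 0 := by
    intro l hl
    rw [integral_const_mul, integral_cos_mul_cos (Finset.mem_Ico.1 hl).1]
    split_ifs with h
    · subst h; ring
    · simp
  rw [Finset.sum_congr rfl this, Finset.sum_ite_eq']
  simp only [Finset.mem_Ico, Nat.lt_succ_iff]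

/-- The envelope dominates all partial sums, so integrals pass to the limit; those of the partial
sums are constant once `N ≥ k`. -/
theorem integral_kerLim_mul_cos {u : ℕ → ℝ} {α K : ℝ} (h : AlmostDecreasing u α K)
    (hα0 : 0 < α) (hα1 : α < 1) (γ c : ℝ) (k : ℕ) :
    ∫ x, kerLim u γ x * Real.cos (k * x + c) ∂symMeasure =
      if 1 ≤ k then π * (u k * Real.cos (γ + c)) else 0 := by
  have hlim : Tendsto (fun N => ∫ x, kerSum u γ N x * Real.cos (k * x + c) ∂symMeasure) atTop
      (𝓝 (∫ x, kerLim u γ x * Real.cos (k * x + c) ∂symMeasure)) := by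
    refine tendsto_integral_of_dominated_convergence
      (fun x => (K * (1 / (1 - α) + π) + π) * u 1 * envelope α x) (fun N => ?_)
      ((integrable_envelope hα0 hα1).const_mul _) (fun N => ?_) ?_
    · have := continuous_kerSum u γ N
      exact Continuous.aestronglyMeasurable (by fun_prop)
    · filter_upwards [symMeasure_ae] with x hx
      rw [norm_mul]
      refine (mul_le_of_le_one_right (norm_nonneg _) (Real.abs_cos_le_one _)).trans ?_
      exact h.abs_kerSum_le hα0 hα1 hx.1 hx.2 γ N
    · filter_upwards [symMeasure_ae] with x hx
      exact (h.tendsto_kerSum hα0 hx.1 hx.2 γ).mul_const _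
  refine tendsto_nhds_unique hlim (tendsto_const_nhds.congr' ?_)
  filter_upwards [eventually_ge_atTop k] with N hN
  rw [integral_kerSum_mul_cos]
  simp [hN]

theorem cosCoeff_kerLim {u : ℕ → ℝ} {α K : ℝ} (h : AlmostDecreasing u α K)
    (hα0 : 0 < α) (hα1 : α < 1) (γ : ℝ) (k : ℕ) :
    cosCoeff (kerLim u γ) k = if 1 ≤ k then u k * Real.cos γ else 0 := by
  have := integral_kerLim_mul_cos h hα0 hα1 γ 0 k
  simp only [add_zero, integral_mul_cos_mul] at this
  refine mul_left_cancel₀ Real.pi_ne_zero (this.trans ?_)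
  split_ifs <;> simp

theorem sinCoeff_kerLim {u : ℕ → ℝ} {α K : ℝ} (h : AlmostDecreasing u α K)
    (hα0 : 0 < α) (hα1 : α < 1) (γ : ℝ) (k : ℕ) :
    sinCoeff (kerLim u γ) k = if 1 ≤ k then u k * Real.sin γ else 0 := by
  have := integral_kerLim_mul_cos h hα0 hα1 γ (-(π / 2)) k
  simp only [← sub_eq_add_neg, Real.cos_sub_pi_div_two, integral_mul_sin_mul] at this
  refine mul_left_cancel₀ Real.pi_ne_zero (this.trans ?_)
  split_ifs <;> simp

theorem isKernel_kerLim {ψ : ℝ → ℝ} {α K : ℝ} (h : AlmostDecreasing (fun k => ψ k) α K)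
    (hα0 : 0 < α) (hα1 : α < 1) (β : ℝ) :
    IsKernel ψ β (kerLim (fun k => ψ k) (β * π / 2)) := by
  refine ⟨memPerLp_kerLim h hα0 hα1 _, ?_, fun k hk => ⟨?_, ?_⟩⟩
  · rw [cosCoeff_kerLim h hα0 hα1]; simp
  · rw [cosCoeff_kerLim h hα0 hα1, if_pos hk]
  · rw [sinCoeff_kerLim h hα0 hα1, if_pos hk]

/-- `psiClass` allows any kernel with the prescribed coefficients; this transfers the pointwise
bounds to all of them. -/
theorem IsKernel.ae_eq_kerLim {ψ : ℝ → ℝ} {α K : ℝ} (h : AlmostDecreasing (fun k => ψ k) α K)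
    (hα0 : 0 < α) (hα1 : α < 1) {β : ℝ} {Ψ : ℝ → ℝ} (hΨ : IsKernel ψ β Ψ) :
    Ψ =ᵐ[symMeasure] kerLim (fun k => ψ k) (β * π / 2) := by
  have hG := isKernel_kerLim h hα0 hα1 β
  have hs0 : ∀ f : ℝ → ℝ, sinCoeff f 0 = 0 := fun f => by simp [sinCoeff]
  refine ae_eq_of_coeff_eq hΨ.1.integrable hG.1.integrable (fun k => ?_) (fun k => ?_)
  · rcases Nat.eq_zero_or_pos k with rfl | hk
    · rw [hΨ.2.1, hG.2.1]
    · rw [(hΨ.2.2 k hk).1, (hG.2.2 k hk).1]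
  · rcases Nat.eq_zero_or_pos k with rfl | hk
    · rw [hs0, hs0]
    · rw [(hΨ.2.2 k hk).2, (hG.2.2 k hk).2]

theorem IsKernel.fourierSum_eq {ψ : ℝ → ℝ} {β : ℝ} {Ψ : ℝ → ℝ} (hΨ : IsKernel ψ β Ψ) (m : ℕ)
    (x : ℝ) : fourierSum m Ψ x = kerSum (fun k => ψ k) (β * π / 2) m x := by
  rw [fourierSum, hΨ.2.1, zero_div, zero_add, kerSum]
  refine Finset.sum_congr rfl fun k hk => ?_
  have hk1 := (Finset.mem_Icc.1 hk).1
  rw [(hΨ.2.2 k hk1).1, (hΨ.2.2 k hk1).2, Real.cos_sub]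
  ring

/-! ### Norms of the kernel remainder and the upper bound -/

theorem sub_fourierSum_periodic {f : ℝ → ℝ} (hf : Function.Periodic f (2 * π)) (m : ℕ) :
    Function.Periodic (fun x => f x - fourierSum m f x) (2 * π) :=
  hf.sub (fourierSum_periodic m f)

theorem eLpNorm_comp_mul_left {H : ℝ → ℝ} {p : ℝ≥0∞} (hpt : p ≠ ∞) {a : ℝ}
    (ha : 0 < a) : eLpNorm (fun x => H (a * x)) p volume =
      ENNReal.ofReal (a ^ (-(1 / p.toReal))) * eLpNorm H p volume := by
  have h1 : eLpNorm H p (Measure.map (fun x : ℝ => a * x) volume) =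
      eLpNorm (fun x => H (a * x)) p volume :=
    (Homeomorph.mulLeft₀ a ha.ne').measurableEmbedding.eLpNorm_map_measure
  rw [← h1, Real.map_volume_mul_left ha.ne', eLpNorm_smul_measure_of_ne_top hpt, smul_eq_mul,
    abs_of_pos (inv_pos.2 ha), ENNReal.ofReal_rpow_of_pos (inv_pos.2 ha), Real.inv_rpow ha.le,
    Real.rpow_neg ha.le]
  simp

/-- The `L_p` norm of the remainder of the kernel, `1 < p < ∞`. -/
theorem exists_perNorm_remainder_le {ψ : ℝ → ℝ} {α K : ℝ}
    (h : AlmostDecreasing (fun k => ψ k) α K) (hα0 : 0 < α) (hα1 : α < 1) {p : ℝ≥0∞}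
    (hp : 1 < p) (hpt : p ≠ ∞) (hα : -1 < (α - 1) * p.toReal) :
    ∃ C : ℝ, 0 < C ∧ ∀ (β : ℝ) (n : ℕ) (Ψ : ℝ → ℝ), 1 ≤ n → IsKernel ψ β Ψ →
      perNorm p (fun x => Ψ x - fourierSum (n - 1) Ψ x) ≤
        ENNReal.ofReal (C * (ψ n * (n : ℝ) ^ (1 - 1 / p.toReal))) := by
  have hK := h.const_pos
  have hpi := Real.pi_pos
  have h1α : 0 < 1 - α := by linarith
  set C₀ := K * (1 / (1 - α) + π) + π with hC₀
  have hC₀p : 0 < C₀ := by positivity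
  set A := (eLpNorm (envelope α) p volume).toReal with hA
  have hA' : eLpNorm (envelope α) p volume = ENNReal.ofReal A :=
    (ENNReal.ofReal_toReal (memLp_envelope hp hpt hα).eLpNorm_ne_top).symm
  have hA0 : 0 ≤ A := ENNReal.toReal_nonneg
  -- Only `A ≥ 0` is at hand; the added 1 makes the constant positive.
  refine ⟨C₀ * (A + 1), by positivity, fun β n Ψ hn hΨ => ?_⟩
  have hn0 : (0 : ℝ) < n := by exact_mod_cast hn
  have hψ : 0 < ψ n := h.pos n hn
  rw [perNorm_eq_symMeasure (sub_fourierSum_periodic hΨ.1.1 _)]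
  have hb : ∀ᵐ x ∂symMeasure, ‖Ψ x - fourierSum (n - 1) Ψ x‖ ≤
      ‖C₀ * (ψ n * n) * envelope α (n * x)‖ := by
    filter_upwards [hΨ.ae_eq_kerLim h hα0 hα1, symMeasure_ae] with x hx hx2
    rw [hx, hΨ.fourierSum_eq, Real.norm_eq_abs, Real.norm_eq_abs]
    refine le_trans ?_ (le_abs_self _)
    exact h.abs_kerLim_sub_le hα0 hx2.1 hx2.2 _ hn fun b hb =>
      h.abs_sum_le_envelope hα0 hα1 hn hb hx2.1 hx2.2 _
  calc eLpNorm (fun x => Ψ x - fourierSum (n - 1) Ψ x) p symMeasure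
      ≤ eLpNorm (fun x => C₀ * (ψ n * n) * envelope α (n * x)) p symMeasure :=
        eLpNorm_mono_ae hb
    -- On the whole line the dilation by `n` scales the norm exactly, by `n^{-1/p}`.
    _ ≤ eLpNorm (fun x => C₀ * (ψ n * n) * envelope α (n * x)) p volume :=
        eLpNorm_mono_measure _ Measure.restrict_le_self
    _ = ENNReal.ofReal (C₀ * (ψ n * n)) *
          (ENNReal.ofReal ((n : ℝ) ^ (-(1 / p.toReal))) * ENNReal.ofReal A) := by
        rw [← hA', ← eLpNorm_comp_mul_left hpt hn0]
        have := eLpNorm_const_smul (C₀ * (ψ n * n)) (fun x => envelope α (n * x)) p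
          (volume : Measure ℝ)
        rw [Real.enorm_of_nonneg (by positivity)] at this
        exact this
    _ ≤ _ := by
        rw [← ENNReal.ofReal_mul (by positivity), ← ENNReal.ofReal_mul (by positivity)]
        refine ENNReal.ofReal_le_ofReal ?_
        have e : (n : ℝ) ^ (1 - 1 / p.toReal) = n * (n : ℝ) ^ (-(1 / p.toReal)) := by
          rw [sub_eq_add_neg, Real.rpow_add hn0, Real.rpow_one]
        rw [e]
        calc _ = C₀ * A * (ψ n * (n * (n : ℝ) ^ (-(1 / p.toReal)))) := by ring
          _ ≤ _ := by gcongr; linarith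

/-- The uniform norm of the remainder of the kernel. -/
theorem exists_perNorm_top_remainder_le {ψ : ℝ → ℝ} {α K : ℝ}
    (h : AlmostDecreasing (fun k => ψ k) α K) (hα : 1 < α) :
    ∃ C : ℝ, 0 < C ∧ ∀ (β : ℝ) (n : ℕ) (Ψ : ℝ → ℝ), 1 ≤ n → IsKernel ψ β Ψ →
      perNorm ∞ (fun x => Ψ x - fourierSum (n - 1) Ψ x) ≤ ENNReal.ofReal (C * (ψ n * n)) := by
  have hK := h.const_pos
  have h1α : 0 < α - 1 := by linarith
  refine ⟨K * (1 + 1 / (α - 1)), by positivity, fun β n Ψ hn hΨ => ?_⟩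
  have hψ : 0 < ψ n := h.pos n hn
  -- Any exponent in `(0, 1)` would do: it only identifies `Ψ` with `kerLim`, while the size
  -- estimate uses `α > 1`.
  have h' := h.mono (α' := 1 / 2) (by linarith)
  rw [perNorm_eq_symMeasure (sub_fourierSum_periodic hΨ.1.1 _), eLpNorm_exponent_top]
  refine essSup_le_of_ae_le _ ?_
  filter_upwards [hΨ.ae_eq_kerLim h' (by norm_num) (by norm_num), symMeasure_ae] with x hx hx2
  rw [hx, hΨ.fourierSum_eq, Real.enorm_eq_ofReal_abs]
  refine ENNReal.ofReal_le_ofReal ?_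
  exact h'.abs_kerLim_sub_le (by norm_num) hx2.1 hx2.2 _ hn fun b hb =>
    h.abs_sum_le_of_one_lt hα hn hb _ _

/-- The deviation is `1/π` times the convolution of the kernel remainder with `φ`; Young's
inequality, `‖φ‖_1 ≤ 1` and `1/π ≤ 1` leave the norm of the remainder. -/
theorem fourierDeviation_le {ψ : ℝ → ℝ} {β : ℝ} {n : ℕ} {p : ℝ≥0∞} (hp : 1 ≤ p) {M : ℝ≥0∞}
    (hM : ∀ Ψ, IsKernel ψ β Ψ → perNorm p (fun x => Ψ x - fourierSum (n - 1) Ψ x) ≤ M) :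
    fourierDeviation n (psiClass ψ β 1) p ≤ M := by
  refine iSup₂_le ?_
  rintro f ⟨hf, Ψ, a₀, φ, hΨ, hφ, hφ1, -, hfe⟩
  have hfe' : f =ᵐ[symMeasure] fun x => a₀ / 2 + 1 / π * perConv Ψ φ x :=
    (Measure.absolutelyContinuous_of_le Measure.restrict_le_self).ae_le hfe
  have hS : MemPerLp 1 (fourierSum (n - 1) Ψ) :=
    (continuous_fourierSum _ Ψ).memPerLp_one (fourierSum_periodic _ Ψ)
  have hR : MemPerLp 1 (fun u => Ψ u - fourierSum (n - 1) Ψ u) :=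
    ⟨hΨ.1.1.sub hS.1, hΨ.1.2.sub hS.2⟩
  rw [perNorm_eq_symMeasure (sub_fourierSum_periodic hf _),
    eLpNorm_congr_ae (sub_fourierSum_ae hΨ.1 hφ hfe' (n - 1))]
  calc eLpNorm (fun x => 1 / π * perConv (fun u => Ψ u - fourierSum (n - 1) Ψ u) φ x) p symMeasure
      ≤ eLpNorm (perConv (fun u => Ψ u - fourierSum (n - 1) Ψ u) φ) p symMeasure := by
        refine eLpNorm_mono fun x => ?_
        rw [norm_mul]
        refine mul_le_of_le_one_left (norm_nonneg _) ?_
        rw [Real.norm_of_nonneg (by positivity), div_le_one Real.pi_pos]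
        linarith [Real.pi_gt_three]
    _ = perNorm p (perConv (fun u => Ψ u - fourierSum (n - 1) Ψ u) φ) :=
        (perNorm_eq_symMeasure (perConv_periodic φ hR.1) p).symm
    _ ≤ perNorm p (fun u => Ψ u - fourierSum (n - 1) Ψ u) * perNorm 1 φ :=
        perNorm_perConv_le hR hφ hp
    _ ≤ M * 1 := by gcongr; exact hM Ψ hΨ
    _ = M := mul_one M

theorem bestApprox_le_fourierDeviation (n : ℕ) (N : Set (ℝ → ℝ)) (p : ℝ≥0∞) :
    bestApprox n N p ≤ fourierDeviation n N p :=
  iSup₂_mono fun f _ => iInf₂_le _ (fourierSum_mem_trigPolys (n - 1) f)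

/-! ### The Fejér kernel and the test function -/

/-- The Fejér kernel `∑_{|l| ≤ N} (1 - |l|/(N+1)) cos(l x)`, written as a double sum. -/
noncomputable def fejer (N : ℕ) (x : ℝ) : ℝ :=
  1 / ((N : ℝ) + 1) * ∑ i ∈ Finset.range (N + 1), ∑ j ∈ Finset.range (N + 1),
    Real.cos (((i : ℝ) - j) * x)

theorem continuous_fejer (N : ℕ) : Continuous (fejer N) := by unfold fejer; fun_prop

theorem fejer_periodic (N : ℕ) : Function.Periodic (fejer N) (2 * π) := by
  intro x
  simp only [fejer]
  congr 1
  refine Finset.sum_congr rfl fun i _ => Finset.sum_congr rfl fun j _ => ?_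
  rw [show ((i : ℝ) - j) * (x + 2 * π) = (i - j) * x + ((i - j : ℤ) : ℝ) * (2 * π) by
    push_cast; ring, Real.cos_add_int_mul_two_pi]

theorem fejer_neg (N : ℕ) (x : ℝ) : fejer N (-x) = fejer N x := by
  simp [fejer]

theorem fejer_eq_sq (N : ℕ) (x : ℝ) : fejer N x = 1 / ((N : ℝ) + 1) *
    ((∑ i ∈ Finset.range (N + 1), Real.cos (i * x)) ^ 2 +
      (∑ i ∈ Finset.range (N + 1), Real.sin (i * x)) ^ 2) := by
  rw [fejer, sq, sq, Finset.sum_mul_sum, Finset.sum_mul_sum, ← Finset.sum_add_distrib]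
  congr 1
  refine Finset.sum_congr rfl fun i _ => ?_
  rw [← Finset.sum_add_distrib]
  refine Finset.sum_congr rfl fun j _ => ?_
  rw [sub_mul, Real.cos_sub]

theorem fejer_nonneg (N : ℕ) (x : ℝ) : 0 ≤ fejer N x := by
  rw [fejer_eq_sq]; positivity

theorem fejer_le (N : ℕ) (x : ℝ) : fejer N x ≤ N + 1 := by
  have h : ∑ i ∈ Finset.range (N + 1), ∑ j ∈ Finset.range (N + 1), Real.cos (((i : ℝ) - j) * x) ≤
      ∑ _i ∈ Finset.range (N + 1), ∑ _j ∈ Finset.range (N + 1), (1 : ℝ) :=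
    Finset.sum_le_sum fun i _ => Finset.sum_le_sum fun j _ => Real.cos_le_one _
  simp only [Finset.sum_const, Finset.card_range, nsmul_eq_mul, mul_one] at h
  push_cast at h
  rw [fejer, one_div_mul_eq_div, div_le_iff₀ (by positivity)]
  exact h

theorem integrable_symMeasure_of_continuous {f : ℝ → ℝ} (hf : Continuous f) :
    Integrable f symMeasure :=
  (hf.integrableOn_Icc (μ := volume) (a := -π) (b := π)).mono_set Ioc_subset_Icc_self

theorem integral_cos_int_mul (l : ℤ) :
    ∫ x, Real.cos (l * x) ∂symMeasure = if l = 0 then 2 * π else 0 := by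
  split_ifs with h
  · subst h
    simp only [Int.cast_zero, zero_mul, Real.cos_zero]
    rw [integral_const_symMeasure, mul_one]
  · simpa using integral_cos_int_mul_add h 0

theorem integral_fejer_mul (N : ℕ) {h : ℝ → ℝ} (hh : Continuous h) :
    ∫ x, fejer N x * h x ∂symMeasure = 1 / ((N : ℝ) + 1) *
      ∑ i ∈ Finset.range (N + 1), ∑ j ∈ Finset.range (N + 1),
        ∫ x, Real.cos (((i : ℝ) - j) * x) * h x ∂symMeasure := by
  simp only [fejer, mul_assoc, Finset.sum_mul]
  rw [integral_const_mul, integral_finsetSum _ fun i _ =>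
    integrable_symMeasure_of_continuous (by fun_prop)]
  congr 1
  refine Finset.sum_congr rfl fun i _ => ?_
  rw [integral_finsetSum _ fun j _ => integrable_symMeasure_of_continuous (by fun_prop)]

theorem integral_fejer (N : ℕ) : ∫ x, fejer N x ∂symMeasure = 2 * π := by
  have h := integral_fejer_mul N (h := fun _ => 1) continuous_const
  simp only [mul_one] at h
  have e : ∀ i ∈ Finset.range (N + 1), ∑ j ∈ Finset.range (N + 1),
      ∫ x, Real.cos (((i : ℝ) - j) * x) ∂symMeasure = 2 * π := by
    intro i hi
    have e1 : ∀ j ∈ Finset.range (N + 1), ∫ x, Real.cos (((i : ℝ) - j) * x) ∂symMeasure =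
        if i = j then 2 * π else 0 := by
      intro j _
      have := integral_cos_int_mul (i - j : ℤ)
      push_cast at this
      rw [this]
      simp only [sub_eq_zero, Nat.cast_inj]
    rw [Finset.sum_congr rfl e1, Finset.sum_ite_eq, if_pos hi]
  rw [h, Finset.sum_congr rfl e]
  simp only [Finset.sum_const, Finset.card_range, nsmul_eq_mul]
  push_cast
  have : (N : ℝ) + 1 ≠ 0 := by positivity
  field_simp

theorem integral_cos_int_mul_cos (l k : ℤ) :
    ∫ x, Real.cos (l * x) * Real.cos (k * x) ∂symMeasure =
      (if l = k then π else 0) + if l = -k then π else 0 := by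
  have e : ∀ x : ℝ, Real.cos (l * x) * Real.cos (k * x) =
      1 / 2 * (Real.cos (((l - k : ℤ) : ℝ) * x) + Real.cos (((l + k : ℤ) : ℝ) * x)) := by
    intro x
    push_cast
    rw [sub_mul, add_mul, Real.cos_sub, Real.cos_add]; ring
  simp only [e]
  rw [integral_const_mul, integral_add (integrable_symMeasure_of_continuous (by fun_prop))
    (integrable_symMeasure_of_continuous (by fun_prop)), integral_cos_int_mul, integral_cos_int_mul]
  simp only [sub_eq_zero, add_eq_zero_iff_eq_neg]
  split_ifs <;> ring

/-- At least `N + 1 - k ≥ (N + 1)/2` pairs satisfy `i - j = k`; each contributes at least `π` and no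
pair contributes negatively. -/
theorem half_le_cosCoeff_fejer {N k : ℕ} (hk : 2 * k ≤ N + 1) : 1 / 2 ≤ cosCoeff (fejer N) k := by
  have h := integral_fejer_mul N (h := fun x => Real.cos (k * x)) (by fun_prop)
  rw [integral_mul_cos_mul] at h
  have e : ∀ i j : ℕ, ∫ x, Real.cos (((i : ℝ) - j) * x) * Real.cos (k * x) ∂symMeasure =
      (if (i : ℤ) - j = k then π else 0) + if (i : ℤ) - j = -k then π else 0 := by
    intro i j
    have := integral_cos_int_mul_cos (i - j) k
    push_cast at this
    exact this
  have hpi := Real.pi_pos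
  have hsum : ((N : ℝ) + 1) / 2 * π ≤ ∑ i ∈ Finset.range (N + 1), ∑ j ∈ Finset.range (N + 1),
      ∫ x, Real.cos (((i : ℝ) - j) * x) * Real.cos (k * x) ∂symMeasure := by
    rw [Finset.sum_comm]
    calc ((N : ℝ) + 1) / 2 * π ≤ ∑ _j ∈ Finset.range (N + 1 - k), π := by
          rw [Finset.sum_const, Finset.card_range, nsmul_eq_mul]
          gcongr
          rw [Nat.cast_sub (by omega)]
          have : (2 : ℝ) * k ≤ N + 1 := by exact_mod_cast hk
          push_cast; linarith
      _ ≤ ∑ j ∈ Finset.range (N + 1 - k), ∑ i ∈ Finset.range (N + 1),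
            ∫ x, Real.cos (((i : ℝ) - j) * x) * Real.cos (k * x) ∂symMeasure := by
          refine Finset.sum_le_sum fun j hj => ?_
          have hj' := Finset.mem_range.1 hj
          have h1 := Finset.single_le_sum (s := Finset.range (N + 1))
            (f := fun i : ℕ => ∫ x, Real.cos (((i : ℝ) - j) * x) * Real.cos (k * x) ∂symMeasure)
            (fun i _ => by simp only [e]; split_ifs <;> positivity)
            (Finset.mem_range.2 (show j + k < N + 1 by omega))
          refine le_trans ?_ h1
          simp only [e]
          rw [if_pos (by push_cast; ring)]
          split_ifs <;> linarith
      _ ≤ _ := by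
          refine Finset.sum_le_sum_of_subset_of_nonneg
            (Finset.range_subset_range.2 (by omega)) fun j _ _ => Finset.sum_nonneg fun i _ => ?_
          simp only [e]; split_ifs <;> positivity
  have hN : (0 : ℝ) < N + 1 := by positivity
  have h2 : 1 / 2 * π ≤ π * cosCoeff (fejer N) k := by
    rw [h, one_div_mul_eq_div ((N : ℝ) + 1), le_div_iff₀ hN]
    linarith
  nlinarith

theorem sinCoeff_eq_zero_of_even {f : ℝ → ℝ} (hf : ∀ x, f (-x) = f x) (k : ℕ) :
    sinCoeff f k = 0 := by
  have h := intervalIntegral.integral_comp_neg (a := -π) (b := π)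
    (fun t => f t * Real.sin (k * t))
  simp only [hf, mul_neg, Real.sin_neg, neg_neg, intervalIntegral.integral_neg] at h
  have : ∫ t in (-π)..π, f t * Real.sin (k * t) = 0 := by linarith
  rw [sinCoeff, this, mul_zero]

/-- The normalized mean-zero Fejér kernel, a function of `L_1` norm at most one. -/
noncomputable def testFun (N : ℕ) (x : ℝ) : ℝ := 1 / (4 * π) * (fejer N x - 1)

theorem memPerLp_testFun (N : ℕ) : MemPerLp 1 (testFun N) := by
  refine Continuous.memPerLp_one ?_ fun x => ?_
  · have := continuous_fejer N
    unfold testFun; fun_prop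
  · simp only [testFun, fejer_periodic N x]

theorem integral_testFun (N : ℕ) : ∫ t in (-π)..π, testFun N t = 0 := by
  rw [intervalIntegral_eq_symMeasure]
  simp only [testFun]
  rw [integral_const_mul, integral_sub (integrable_symMeasure_of_continuous (continuous_fejer N))
    (integrable_const _), integral_fejer, integral_const_symMeasure]
  ring

/-- `|F_N - 1| ≤ F_N + 1`, whose integral is `4π`; hence the normalization. -/
theorem perNorm_testFun_le (N : ℕ) : perNorm 1 (testFun N) ≤ 1 := by
  have hpi := Real.pi_pos
  have hc := continuous_fejer N
  rw [perNorm_eq_symMeasure (memPerLp_testFun N).1, eLpNorm_one_eq_lintegral_enorm]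
  calc ∫⁻ x, ‖testFun N x‖ₑ ∂symMeasure
      ≤ ∫⁻ x, ENNReal.ofReal (1 / (4 * π) * (fejer N x + 1)) ∂symMeasure := by
        refine lintegral_mono fun x => ?_
        simp only [Real.enorm_eq_ofReal_abs]
        refine ENNReal.ofReal_le_ofReal ?_
        rw [testFun, abs_mul, abs_of_pos (by positivity : 0 < 1 / (4 * π))]
        gcongr
        rw [abs_le]
        constructor <;> linarith [fejer_nonneg N x]
    _ = ENNReal.ofReal (∫ x, 1 / (4 * π) * (fejer N x + 1) ∂symMeasure) := by
        refine (ofReal_integral_eq_lintegral_ofReal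
          (integrable_symMeasure_of_continuous (by fun_prop)) (Eventually.of_forall fun x => ?_)).symm
        have := fejer_nonneg N x
        positivity
    _ = 1 := by
        rw [integral_const_mul, integral_add (integrable_symMeasure_of_continuous hc)
          (integrable_const _), integral_fejer, integral_const_symMeasure]
        rw [show 1 / (4 * π) * (2 * π + 2 * π * 1) = 1 by field_simp; norm_num]
        exact ENNReal.ofReal_one

theorem sinCoeff_testFun (N k : ℕ) : sinCoeff (testFun N) k = 0 :=
  sinCoeff_eq_zero_of_even (fun x => by simp only [testFun, fejer_neg]) k

theorem le_cosCoeff_testFun {N k : ℕ} (hk1 : 1 ≤ k) (hk : 2 * k ≤ N + 1) :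
    1 / (8 * π) ≤ cosCoeff (testFun N) k := by
  have hpi := Real.pi_pos
  have h1 := integrable_symMeasure_of_continuous (continuous_fejer N)
  have h2 : ∫ x, testFun N x * Real.cos (k * x) ∂symMeasure =
      1 / (4 * π) * (π * cosCoeff (fejer N) k - 0) := by
    have := integral_cos_nat_mul_add hk1 0
    simp only [add_zero] at this
    rw [← this, ← integral_mul_cos_mul, ← integral_sub (Integrable.mul_cos_mul h1 k)
      (integrable_symMeasure_of_continuous (by fun_prop)), ← integral_const_mul]
    congr 1; ext x; rw [testFun]; ring
  rw [integral_mul_cos_mul, sub_zero] at h2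
  have h3 : cosCoeff (testFun N) k = 1 / (4 * π) * cosCoeff (fejer N) k := by
    refine mul_left_cancel₀ hpi.ne' (h2.trans ?_); ring
  rw [h3]
  calc 1 / (8 * π) = 1 / (4 * π) * (1 / 2) := by field_simp; norm_num
    _ ≤ _ := by gcongr; exact half_le_cosCoeff_fejer hk

/-! ### Duality and the lower bound -/

/-- Modulation shifts the spectrum by `m` and keeps one phase `γ` throughout; the sine parts cancel
under `i ↔ j`. The condition `r ≤ m` makes the natural subtraction exact. -/
theorem fejer_mul_cos (r : ℕ) {m : ℕ} (hm : r ≤ m) (γ x : ℝ) :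
    fejer r x * Real.cos (m * x - γ) = 1 / ((r : ℝ) + 1) *
      ∑ i ∈ Finset.range (r + 1), ∑ j ∈ Finset.range (r + 1),
        Real.cos (((m + i - j : ℕ) : ℝ) * x - γ) := by
  have e : ∀ i ∈ Finset.range (r + 1), ∀ j ∈ Finset.range (r + 1),
      Real.cos (((m + i - j : ℕ) : ℝ) * x - γ) =
        Real.cos (((i : ℝ) - j) * x) * Real.cos (m * x - γ) -
          Real.sin (((i : ℝ) - j) * x) * Real.sin (m * x - γ) := by
    intro i hi j hj
    have hj' := Finset.mem_range.1 hj
    rw [Nat.cast_sub (by omega), Nat.cast_add,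
      show ((m : ℝ) + i - j) * x - γ = (i - j) * x + (m * x - γ) by ring, Real.cos_add]
  have hodd : ∑ i ∈ Finset.range (r + 1), ∑ j ∈ Finset.range (r + 1),
      Real.sin (((i : ℝ) - j) * x) = 0 := by
    have h : ∑ i ∈ Finset.range (r + 1), ∑ j ∈ Finset.range (r + 1), Real.sin (((i : ℝ) - j) * x) =
        -∑ i ∈ Finset.range (r + 1), ∑ j ∈ Finset.range (r + 1), Real.sin (((i : ℝ) - j) * x) := by
      conv_lhs => rw [Finset.sum_comm]
      rw [← Finset.sum_neg_distrib]
      refine Finset.sum_congr rfl fun i _ => ?_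
      rw [← Finset.sum_neg_distrib]
      refine Finset.sum_congr rfl fun j _ => ?_
      rw [← Real.sin_neg]; congr 1; ring
    linarith
  rw [Finset.sum_congr rfl fun i hi => Finset.sum_congr rfl fun j hj => e i hi j hj]
  simp only [Finset.sum_sub_distrib, ← Finset.sum_mul]
  rw [hodd, fejer]; ring

theorem integral_trigPoly_mul_cos {m k : ℕ} (hk : m < k) {t : ℝ → ℝ} (ht : t ∈ trigPolys m)
    (γ : ℝ) : ∫ x, t x * Real.cos (k * x - γ) ∂symMeasure = 0 := by
  obtain ⟨c, a, b, ht⟩ := ht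
  have hi : ∀ l ∈ Finset.Icc 1 m, Integrable (fun x : ℝ =>
      a l * (Real.cos (l * x - 0) * Real.cos (k * x + -γ)) +
        b l * (Real.cos (l * x - π / 2) * Real.cos (k * x + -γ))) symMeasure :=
    fun l _ => integrable_symMeasure_of_continuous (by fun_prop)
  have e : ∀ x, t x * Real.cos (k * x - γ) = c * Real.cos (k * x + -γ) +
      ∑ l ∈ Finset.Icc 1 m, (a l * (Real.cos (l * x - 0) * Real.cos (k * x + -γ)) +
        b l * (Real.cos (l * x - π / 2) * Real.cos (k * x + -γ))) := by
    intro x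
    rw [ht, add_mul, Finset.sum_mul, sub_eq_add_neg]
    congr 1
    refine Finset.sum_congr rfl fun l _ => ?_
    rw [sub_zero, Real.cos_sub_pi_div_two]; ring
  simp only [e]
  rw [integral_add (integrable_symMeasure_of_continuous (by fun_prop)) (integrable_finsetSum _ hi),
    integral_finsetSum _ hi, integral_const_mul, integral_cos_nat_mul_add (by omega), mul_zero,
    zero_add]
  refine Finset.sum_eq_zero fun l hl => ?_
  have hl' := Finset.mem_Icc.1 hl
  rw [integral_add (integrable_symMeasure_of_continuous (by fun_prop))
    (integrable_symMeasure_of_continuous (by fun_prop)), integral_const_mul, integral_const_mul,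
    integral_cos_mul_cos hl'.1, integral_cos_mul_cos hl'.1, if_neg (by omega),
    if_neg (by omega), mul_zero, mul_zero, add_zero]

theorem continuous_of_mem_trigPolys {m : ℕ} {t : ℝ → ℝ} (ht : t ∈ trigPolys m) :
    Continuous t := by
  obtain ⟨c, a, b, ht⟩ := ht
  rw [funext ht]; fun_prop

theorem periodic_of_mem_trigPolys {m : ℕ} {t : ℝ → ℝ} (ht : t ∈ trigPolys m) :
    Function.Periodic t (2 * π) := by
  obtain ⟨c, a, b, ht⟩ := ht
  intro x
  rw [ht, ht]
  congr 1
  refine Finset.sum_congr rfl fun k _ => ?_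
  have h1 : (k : ℝ) * (x + 2 * π) = k * x + k * (2 * π) := by ring
  rw [h1, Real.cos_add_nat_mul_two_pi, Real.sin_add_nat_mul_two_pi]

/-- Interpolation between `‖F_r‖_1 = 2π` and `F_r ≤ r + 1`, through `F_r^q ≤ (r+1)^{q-1} F_r`. -/
theorem eLpNorm_fejer_le (r : ℕ) {q : ℝ} (hq : 1 ≤ q) :
    eLpNorm (fejer r) (ENNReal.ofReal q) symMeasure ≤
      ENNReal.ofReal (2 * π * ((r : ℝ) + 1) ^ (1 - 1 / q)) := by
  have hq0 : 0 < q := by linarith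
  have hpi := Real.pi_gt_three
  rw [eLpNorm_eq_lintegral_rpow_enorm_toReal (by simpa using hq0) ENNReal.ofReal_ne_top,
    ENNReal.toReal_ofReal hq0.le]
  have h1 : ∫⁻ x, ‖fejer r x‖ₑ ^ q ∂symMeasure ≤
      ENNReal.ofReal (((r : ℝ) + 1) ^ (q - 1) * (2 * π)) := by
    calc ∫⁻ x, ‖fejer r x‖ₑ ^ q ∂symMeasure
        ≤ ∫⁻ x, ENNReal.ofReal (((r : ℝ) + 1) ^ (q - 1) * fejer r x) ∂symMeasure := by
          refine lintegral_mono fun x => ?_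
          have h0 := fejer_nonneg r x
          simp only [Real.enorm_of_nonneg h0]
          rw [ENNReal.ofReal_rpow_of_nonneg h0 hq0.le]
          refine ENNReal.ofReal_le_ofReal ?_
          rcases h0.eq_or_lt with h | h
          · rw [← h, Real.zero_rpow hq0.ne', mul_zero]
          · have : fejer r x ^ q = fejer r x ^ (q - 1) * fejer r x := by
              rw [Real.rpow_sub_one h.ne']; field_simp
            rw [this]
            gcongr
            exact fejer_le r x
      _ = ENNReal.ofReal (∫ x, ((r : ℝ) + 1) ^ (q - 1) * fejer r x ∂symMeasure) := by
          have := continuous_fejer r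
          refine (ofReal_integral_eq_lintegral_ofReal
            (integrable_symMeasure_of_continuous (by fun_prop))
            (Eventually.of_forall fun x => ?_)).symm
          have := fejer_nonneg r x
          positivity
      _ = _ := by rw [integral_const_mul, integral_fejer]
  calc _ ≤ (ENNReal.ofReal (((r : ℝ) + 1) ^ (q - 1) * (2 * π))) ^ (1 / q) := by gcongr
    _ = ENNReal.ofReal ((((r : ℝ) + 1) ^ (q - 1) * (2 * π)) ^ (1 / q)) :=
        ENNReal.ofReal_rpow_of_nonneg (by positivity) (by positivity)
    _ ≤ _ := by
        refine ENNReal.ofReal_le_ofReal ?_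
        rw [Real.mul_rpow (by positivity) (by positivity), ← Real.rpow_mul (by positivity), mul_comm,
          show (q - 1) * (1 / q) = 1 - 1 / q by field_simp]
        gcongr
        calc (2 * π) ^ (1 / q) ≤ (2 * π) ^ (1 : ℝ) :=
              Real.rpow_le_rpow_of_exponent_le (by linarith) (by rwa [div_le_one hq0])
          _ = 2 * π := Real.rpow_one _

/-- The test function is even, so matching the phase of the kernel produces `cos² + sin² = 1` and
the bound is free of `β`. -/
theorem le_integral_perConv_mul_cos {ψ : ℝ → ℝ} {β : ℝ} {Ψ : ℝ → ℝ} (hΨ : IsKernel ψ β Ψ)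
    {N k : ℕ} (hk1 : 1 ≤ k) (hk : 2 * k ≤ N + 1) (hψ : 0 ≤ ψ k) :
    ψ k / 8 ≤ ∫ x, 1 / π * perConv Ψ (testFun N) x * Real.cos (k * x - β * π / 2) ∂symMeasure := by
  have hpi := Real.pi_pos
  simp only [mul_assoc (1 / π), sub_eq_add_neg]
  rw [integral_const_mul, integral_perConv_mul_cos hΨ.1 (memPerLp_testFun N), sinCoeff_testFun,
    (hΨ.2.2 k hk1).1, (hΨ.2.2 k hk1).2, Real.cos_neg, Real.sin_neg]
  set γ := β * π / 2
  have e : 1 / π * (π * (π * (ψ k * Real.cos γ * (cosCoeff (testFun N) k * Real.cos γ -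
      0 * -Real.sin γ) - ψ k * Real.sin γ * (cosCoeff (testFun N) k * -Real.sin γ +
        0 * Real.cos γ)))) = π * ψ k * cosCoeff (testFun N) k *
          (Real.sin γ ^ 2 + Real.cos γ ^ 2) := by
    field_simp; ring
  rw [e, Real.sin_sq_add_cos_sq, mul_one]
  calc ψ k / 8 = π * ψ k * (1 / (8 * π)) := by field_simp
    _ ≤ _ := by gcongr; exact le_cosCoeff_testFun hk1 hk

theorem le_bestApprox {ψ : ℝ → ℝ} {β : ℝ} {Ψ : ℝ → ℝ} (hΨ : IsKernel ψ β Ψ) {n : ℕ} (hn : 1 ≤ n)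
    {c : ℝ} (hc : 0 ≤ c) (hψ : ∀ k : ℕ, n ≤ k → k ≤ 3 * n → c ≤ ψ k)
    {p : ℝ≥0∞} {q : ℝ} (hq : 1 ≤ q) (hpq : 1 / p + 1 / ENNReal.ofReal q = 1) :
    ENNReal.ofReal (c * (n : ℝ) ^ (1 / q) / (16 * π)) ≤ bestApprox n (psiClass ψ β 1) p := by
  have hpi := Real.pi_pos
  have hq0 : 0 < q := by linarith
  -- This order gives `2k ≤ N + 1` for all `k ≤ 3n`.
  set N := 6 * n with hN
  set γ := β * π / 2 with hγ
  set f : ℝ → ℝ := fun x => 1 / π * perConv Ψ (testFun N) x with hf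
  have hfper : Function.Periodic f (2 * π) := fun x => by
    simp only [hf, perConv_periodic (testFun N) hΨ.1.1 x]
  have hfint : Integrable f symMeasure := (integrable_perConv hΨ.1 (memPerLp_testFun N)).const_mul _
  have hfmem : f ∈ psiClass ψ β 1 := by
    refine ⟨hfper, Ψ, 0, testFun N, hΨ, memPerLp_testFun N, perNorm_testFun_le N,
      integral_testFun N, Eventually.of_forall fun x => ?_⟩
    simp only [hf, perConv]; ring
  refine le_trans ?_ (le_iSup₂_of_le f hfmem le_rfl)
  refine le_iInf₂ fun t ht => ?_
  have htc := continuous_of_mem_trigPolys ht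
  have hdper : Function.Periodic (fun x => f x - t x) (2 * π) :=
    hfper.sub (periodic_of_mem_trigPolys ht)
  have hdint : Integrable (fun x => f x - t x) symMeasure :=
    hfint.sub (integrable_symMeasure_of_continuous htc)
  -- Centred at `2n` with half-width `n`, its spectrum fills `[n, 3n]`, just above the polynomials
  -- of order `n - 1`.
  set g : ℝ → ℝ := fun x => fejer n x * Real.cos ((2 * n : ℕ) * x - γ) with hg
  have hgc : Continuous g := by
    have := continuous_fejer n
    fun_prop
  have hi : ∀ k : ℕ, Integrable (fun x => (f x - t x) * Real.cos (k * x - γ)) symMeasure := by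
    intro k
    simpa [sub_eq_add_neg] using Integrable.mul_cos_affine hdint k (-γ)
  have hlow : ∀ k : ℕ, n ≤ k → k ≤ 3 * n →
      c / 8 ≤ ∫ x, (f x - t x) * Real.cos (k * x - γ) ∂symMeasure := by
    intro k hk1 hk2
    have h1 : Integrable (fun x => f x * Real.cos (k * x - γ)) symMeasure := by
      simpa [sub_eq_add_neg] using Integrable.mul_cos_affine hfint k (-γ)
    have h2 := integral_trigPoly_mul_cos (show n - 1 < k by omega) ht γ
    simp only [sub_mul]
    rw [integral_sub h1 (integrable_symMeasure_of_continuous (by fun_prop)), h2, sub_zero]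
    have hck := hψ k hk1 hk2
    have h3 := le_integral_perConv_mul_cos hΨ (N := N) (show 1 ≤ k by omega) (by omega)
      (hc.trans hck)
    exact le_trans (by linarith) h3
  have hn1 : (0 : ℝ) < n + 1 := by positivity
  -- There are `(n+1)²` pairs `(i, j)`, each contributing at least `c/8`, against the prefactor
  -- `1/(n+1)`.
  have hint : ((n : ℝ) + 1) * (c / 8) ≤ ∫ x, g x * (f x - t x) ∂symMeasure := by
    have e : ∀ x, g x * (f x - t x) = 1 / ((n : ℝ) + 1) *
        ∑ i ∈ Finset.range (n + 1), ∑ j ∈ Finset.range (n + 1),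
          (f x - t x) * Real.cos (((2 * n + i - j : ℕ) : ℝ) * x - γ) := by
      intro x
      simp only [hg]
      rw [fejer_mul_cos n (show n ≤ 2 * n by omega)]
      simp only [← Finset.mul_sum]; ring
    simp only [e]
    rw [integral_const_mul,
      integral_finsetSum _ fun i _ => integrable_finsetSum _ fun j _ => hi _]
    have hs : ∑ _i ∈ Finset.range (n + 1), ∑ _j ∈ Finset.range (n + 1), c / 8 ≤
        ∑ i ∈ Finset.range (n + 1), ∫ x, ∑ j ∈ Finset.range (n + 1),
          (f x - t x) * Real.cos (((2 * n + i - j : ℕ) : ℝ) * x - γ) ∂symMeasure := by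
      refine Finset.sum_le_sum fun i hi' => ?_
      rw [integral_finsetSum _ fun j _ => hi _]
      refine Finset.sum_le_sum fun j hj' => ?_
      have h1 := Finset.mem_range.1 hi'
      have h2 := Finset.mem_range.1 hj'
      exact hlow _ (by omega) (by omega)
    simp only [Finset.sum_const, Finset.card_range, nsmul_eq_mul] at hs
    push_cast at hs
    rw [one_div_mul_eq_div, le_div_iff₀ hn1]
    linarith
  have hconj : ENNReal.HolderTriple (ENNReal.ofReal q) p 1 :=
    ⟨by rw [← one_div, ← one_div, add_comm, hpq, inv_one]⟩
  have hhol := eLpNorm_smul_le_mul_eLpNorm (p := ENNReal.ofReal q) (q := p) (r := 1)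
    hdint.aestronglyMeasurable (hgc.aestronglyMeasurable (μ := symMeasure))
  have hgn : eLpNorm g (ENNReal.ofReal q) symMeasure ≤
      ENNReal.ofReal (2 * π * ((n : ℝ) + 1) ^ (1 - 1 / q)) := by
    refine le_trans (eLpNorm_mono fun x => ?_) (eLpNorm_fejer_le n hq)
    rw [hg, norm_mul]
    exact mul_le_of_le_one_right (norm_nonneg _) (Real.abs_cos_le_one _)
  rw [perNorm_eq_symMeasure hdper]
  have hP : 0 < 2 * π * ((n : ℝ) + 1) ^ (1 - 1 / q) := by positivity
  have hchain : ENNReal.ofReal (((n : ℝ) + 1) * (c / 8)) ≤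
      ENNReal.ofReal (2 * π * ((n : ℝ) + 1) ^ (1 - 1 / q)) *
        eLpNorm (fun x => f x - t x) p symMeasure := by
    calc ENNReal.ofReal (((n : ℝ) + 1) * (c / 8))
        ≤ ENNReal.ofReal (∫ x, g x * (f x - t x) ∂symMeasure) := ENNReal.ofReal_le_ofReal hint
      _ ≤ ‖∫ x, g x * (f x - t x) ∂symMeasure‖ₑ := by
          rw [Real.enorm_eq_ofReal_abs]
          exact ENNReal.ofReal_le_ofReal (le_abs_self _)
      _ ≤ eLpNorm (g • fun x => f x - t x) 1 symMeasure := by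
          rw [eLpNorm_one_eq_lintegral_enorm]
          exact enorm_integral_le_lintegral_enorm _
      _ ≤ _ := hhol.trans (by gcongr)
  have hdiv : ENNReal.ofReal (((n : ℝ) + 1) * (c / 8) / (2 * π * ((n : ℝ) + 1) ^ (1 - 1 / q))) ≤
      eLpNorm (fun x => f x - t x) p symMeasure := by
    rw [ENNReal.ofReal_div_of_pos hP]
    exact ENNReal.div_le_of_le_mul (hchain.trans_eq (mul_comm _ _))
  refine le_trans (ENNReal.ofReal_le_ofReal ?_) hdiv
  have e : ((n : ℝ) + 1) * (c / 8) / (2 * π * ((n : ℝ) + 1) ^ (1 - 1 / q)) =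
      c * ((n : ℝ) + 1) ^ (1 / q) / (16 * π) := by
    have : ((n : ℝ) + 1) = ((n : ℝ) + 1) ^ (1 / q) * ((n : ℝ) + 1) ^ (1 - 1 / q) := by
      rw [← Real.rpow_add hn1]; simp
    have h0 : ((n : ℝ) + 1) ^ (1 - 1 / q) ≠ 0 := by positivity
    rw [div_eq_div_iff hP.ne' (by positivity)]
    conv_lhs => rw [this]
    ring
  rw [e]
  gcongr
  linarith

/-! ### Consequences of the classes `B` and `Θ`, and the conclusion -/

theorem almostDecreasing_of_mem {ψ : ℝ → ℝ} {q : ℝ} (hB : ψ ∈ classB) (hΘ : ψ ∈ classTheta q) :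
    ∃ α K : ℝ, 1 / q < α ∧ AlmostDecreasing (fun k => ψ k) α K := by
  obtain ⟨hanti, hpos, -⟩ := hB
  obtain ⟨-, α, hα, K, hK, h⟩ := hΘ
  have h1 : ∀ k : ℕ, 1 ≤ k → (1 : ℝ) ≤ k := fun k hk => by exact_mod_cast hk
  -- The class `Θ` compares only distinct points; the case `m = k` needs a constant at least 1.
  refine ⟨α, max K 1, hα, ⟨fun m k hm hk => ?_, fun k hk => hpos k (h1 k hk), fun m k hm hk => ?_,
    lt_of_lt_of_le hK (le_max_left _ _)⟩⟩
  · exact hanti (h1 m hm) (h1 k (hm.trans hk)) (by exact_mod_cast hk)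
  · have hnn : 0 ≤ (m : ℝ) ^ α * ψ m := mul_nonneg (by positivity) (hpos m (h1 m hm)).le
    rcases hk.eq_or_lt with rfl | hlt
    · exact le_mul_of_one_le_left hnn (le_max_right _ _)
    · exact (h k m (h1 m hm) (by exact_mod_cast hlt)).trans
        (mul_le_mul_of_nonneg_right (le_max_left _ _) hnn)

/-- Two doublings reach `4n ≥ 3n` and cost `K²`. -/
theorem exists_le_of_classB {ψ : ℝ → ℝ} (hB : ψ ∈ classB) :
    ∃ c : ℝ, 0 < c ∧ ∀ n k : ℕ, 1 ≤ n → k ≤ 3 * n → 1 ≤ k → c * ψ n ≤ ψ k := by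
  obtain ⟨hanti, hpos, K, hK, h⟩ := hB
  refine ⟨(K * K)⁻¹, by positivity, fun n k hn hk hk1 => ?_⟩
  have h1 : (1 : ℝ) ≤ n := by exact_mod_cast hn
  have h2 := h n h1
  have h3 := h (2 * n) (by linarith)
  have hk3 : (k : ℝ) ≤ 3 * n := by exact_mod_cast hk
  have hk1' : (1 : ℝ) ≤ k := by exact_mod_cast hk1
  rw [div_le_iff₀ (hpos _ (by linarith))] at h2 h3
  have h4 : ψ (2 * (2 * n)) ≤ ψ k :=
    hanti (show (1 : ℝ) ≤ k from hk1') (show (1 : ℝ) ≤ 2 * (2 * n) by linarith) (by linarith)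
  rw [inv_mul_le_iff₀ (by positivity)]
  calc ψ n ≤ K * ψ (2 * n) := h2
    _ ≤ K * (K * ψ (2 * (2 * n))) := by gcongr
    _ ≤ K * (K * ψ k) := by gcongr
    _ = _ := by ring

theorem exists_fourierDeviation_le {p : ℝ≥0∞} (hp : 1 < p) {p' : ℝ} (hp' : 1 ≤ p')
    (hpp' : 1 / p + 1 / ENNReal.ofReal p' = 1) {ψ : ℝ → ℝ} (hB : ψ ∈ classB)
    (hΘ : ψ ∈ classTheta p') :
    ∃ C : ℝ, 0 < C ∧ (∀ β, ∃ Ψ, IsKernel ψ β Ψ) ∧ ∀ (β : ℝ) (n : ℕ), 1 ≤ n →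
      fourierDeviation n (psiClass ψ β 1) p ≤ ENNReal.ofReal (C * (ψ n * (n : ℝ) ^ (1 / p'))) := by
  obtain ⟨α, K, hα, h⟩ := almostDecreasing_of_mem hB hΘ
  have hp'0 : 0 < p' := by linarith
  have hinv : 1 / ENNReal.ofReal p' = ENNReal.ofReal (1 / p') := by
    rw [ENNReal.ofReal_div_of_pos hp'0, ENNReal.ofReal_one]
  rcases eq_or_ne p ∞ with rfl | hpt
  · have hp'1 : 1 / p' = 1 := by
      rw [hinv, ENNReal.div_top, zero_add] at hpp'
      rwa [ENNReal.ofReal_eq_one] at hpp'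
    rw [hp'1] at hα ⊢
    obtain ⟨C, hC, hbound⟩ := exists_perNorm_top_remainder_le h hα
    refine ⟨C, hC, fun β => ⟨_, isKernel_kerLim (h.mono (α' := 1 / 2) (by linarith)) (by norm_num)
      (by norm_num) β⟩, fun β n hn => ?_⟩
    rw [Real.rpow_one]
    exact fourierDeviation_le hp.le fun Ψ hΨ => hbound β n Ψ hn hΨ
  · have hp0 : p ≠ 0 := (zero_lt_one.trans hp).ne'
    have hP : 1 < p.toReal := by
      simpa using (ENNReal.toReal_lt_toReal (by simp) hpt).2 hp
    have hsum : 1 / p' = 1 - 1 / p.toReal := by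
      have := congrArg ENNReal.toReal hpp'
      rw [hinv, ENNReal.toReal_add (by simp [hp0]) ENNReal.ofReal_ne_top,
        ENNReal.toReal_ofReal (by positivity), ENNReal.toReal_div] at this
      simp only [ENNReal.toReal_one] at this
      linarith
    have hlt1 : 1 / p' < 1 := by
      rw [hsum]
      have : 0 < 1 / p.toReal := by positivity
      linarith
    have h0 : 0 < 1 / p' := by positivity
    -- Above `1/p'` the envelope is in `L_p`; below `α` the exponent may be lowered to `α'`; below 1
    -- the pointwise bounds apply.
    obtain ⟨α', hα'1, hα'2⟩ := exists_between (lt_min hα hlt1)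
    have hα'3 := lt_min_iff.1 hα'2
    have h' := h.mono hα'3.1.le
    have hcond : -1 < (α' - 1) * p.toReal := by
      have : -(1 / p.toReal) < α' - 1 := by linarith
      calc -1 = -(1 / p.toReal) * p.toReal := by field_simp
        _ < _ := by gcongr
    obtain ⟨C, hC, hbound⟩ :=
      exists_perNorm_remainder_le h' (h0.trans hα'1) hα'3.2 hp hpt hcond
    refine ⟨C, hC, fun β => ⟨_, isKernel_kerLim h' (h0.trans hα'1) hα'3.2 β⟩, fun β n hn => ?_⟩
    rw [hsum]
    exact fourierDeviation_le hp.le fun Ψ hΨ => hbound β n Ψ hn hΨ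

theorem mainTheorem3 (p : ℝ≥0∞) (hp : 1 < p) (p' : ℝ) (hp' : 1 ≤ p')
    (hpp' : 1 / p + 1 / ENNReal.ofReal p' = 1)
    (ψ : ℝ → ℝ) (hcont : ContinuousOn ψ (Set.Ici 1)) (hψ : ψ ∈ classB ∩ classTheta p')
    (hΔ : (∀ k : ℕ, 1 ≤ k → 0 ≤ secondDiffInv ψ k) ∨
      (∀ k : ℕ, 1 ≤ k → secondDiffInv ψ k ≤ 0)) :
    ∃ K₃ K₄ : ℝ, 0 < K₃ ∧ 0 < K₄ ∧ ∀ (β : ℝ) (n : ℕ), 1 ≤ n →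
      ENNReal.ofReal (K₄ * (ψ n * (n : ℝ) ^ (1 / p'))) ≤ bestApprox n (psiClass ψ β 1) p ∧
      bestApprox n (psiClass ψ β 1) p ≤ fourierDeviation n (psiClass ψ β 1) p ∧
      fourierDeviation n (psiClass ψ β 1) p ≤
        ENNReal.ofReal (K₃ * (ψ n * (n : ℝ) ^ (1 / p'))) := by
  obtain ⟨C, hC, hker, hupper⟩ := exists_fourierDeviation_le hp hp' hpp' hψ.1 hψ.2
  obtain ⟨c, hc, hlower⟩ := exists_le_of_classB hψ.1
  have hpi := Real.pi_pos
  refine ⟨C, c / (16 * π), hC, by positivity, fun β n hn =>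
    ⟨?_, bestApprox_le_fourierDeviation _ _ _, hupper β n hn⟩⟩
  -- Without a kernel the class would be empty and the supremum 0, so existence for every `β` is
  -- essential here.
  obtain ⟨Ψ, hΨ⟩ := hker β
  have hψn : 0 < ψ n := hψ.1.2.1 n (by exact_mod_cast hn)
  have := le_bestApprox hΨ hn (c := c * ψ n) (by positivity)
    (fun k h1 h2 => hlower n k hn h2 (hn.trans h1)) hp' hpp'
  refine le_trans (le_of_eq ?_) this
  congr 1; ring
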